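/- Let $k$ be a field, let $1\le n\le m$, let $R=k[x_{ij}\mid 1\le i\le n,\ 1\le j\le m]$ with the standard grading, and let $M=(x_{ij})$ be the generic $n\times m$ matrix, viewed as a map $F\to G$ of free $R$-modules with bases $f_1,\dots,f_m$ and $g_1,\dots,g_n$. Let $<$ be the lexicographic monomial order with $x_{11}>x_{12}>\cdots>x_{1m}>x_{21}>\cdots>x_{nm}$. Let $\Delta$ be a simplicial complex on the vertex set $[m]$ all of whose facets have exactly $n$ elements. Its determinantal facet ideal $J_\Delta\subseteq R$ is generated by the maximal minors of $M$ on the columns $\sigma$, for the facets $\sigma$ of $\Delta$; $\operatorname{in}_<(J_\Delta)$ is the ideal generated by the leading terms of all elements of $J_\Delta$. The clique complex $\Delta^{\mathrm{clique}}$ is the simplicial complex whose faces with at most $n$ elements are those of $\Delta$ and in which a set with at least $n$ elements is a face if and only if all its $n$-element subsets are faces of $\Delta$. A $1$-nonface of a simplicial complex $\Gamma$ on $[m]$ is a set $\sigma=\{\sigma_1<\dots<\sigma_\ell\}\notin\Gamma$ such that $\sigma\setminus\{\sigma_j\}\in\Gamma$ and $\sigma\setminus\{\sigma_{j+1}\}\in\Gamma$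 for some $1\le j<\ell$. For a simplicial complex $\Gamma$ on $[m]$, the generalized sparse Eagon--Northcott complex $\mathcal C^<_\bullet(\Gamma,M)$ has $\mathcal C^<_0=\bigwedge^nG\cong R$ (generated in degree $0$), and for $i\ge1$ the module $\mathcal C^<_i\subseteq D_{i-1}(G^*)\otimes\bigwedge^{n+i-1}F$ is the free module with basis the elements $g^{*(\alpha)}\otimes f_\sigma$ (of degree $n+i-1$) with $\sigma\in\Gamma$, $|\sigma|=n+i-1$, $\alpha\in\mathbb Z_{\ge0}^n$, $|\alpha|=i-1$. Its differential sends $f_\sigma\in\mathcal C^<_1$ to the leading term of the maximal minor of $M$ on the columns $\sigma$, and for $i\ge2$ and $I=\{I_1<\dots<I_{n+i-1}\}$ it is $$g^{*(\alpha)}\otimes f_I\longmapsto\sum_{a:\,\alpha_a>0}\ \sum_{p}(-1)^{p+1}x_{aI_p}\,g^{*(\alpha-\epsilon_a)}\otimes f_{I\setminus\{I_p\}},$$ where $p$ runs over $a+\alpha_1+\dots+\alpha_{a-1}\le p\le a+\alpha_1+\dots+\alpha_a$ and $\epsilon_a$ is the $a$-th unit vector. Assume that $\Delta^{\mathrm{clique}}$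 has no $1$-nonfaces of cardinality $n+1$. Then $\mathcal C^<_\bullet(\Delta^{\mathrm{clique}},M)$ is a complex, and for every minimal graded free resolution $F_\bullet$ of the ideal $\operatorname{in}_<(J_\Delta)$, with linear strand $F^{\mathrm{lin}}_\bullet$ (where $F^{\mathrm{lin}}_i$ is the summand of $F_i$ generated in degree $n+i$), the linear strand augmented by $R$, $$\cdots\to F_1^{\mathrm{lin}}\to F_0^{\mathrm{lin}}\to R,$$ with $F^{\mathrm{lin}}_0\to\operatorname{in}_<(J_\Delta)\subseteq R$ the augmentation, is isomorphic to $\mathcal C^<_\bullet(\Delta^{\mathrm{clique}},M)$ as a complex of graded $R$-modules ($F^{\mathrm{lin}}_i$ corresponding to $\mathcal C^<_{i+1}$). -/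

import Mathlib

open MvPolynomial

/-! ### Graded free modules over a standard graded polynomial ring

A finitely generated graded free module `⨁ b, R(-deg b)` over `R = k[x_t | t ∈ τ]` is given by
a finite type of basis elements and their degrees; its underlying module is `ι →₀ R`. -/

/-- `p` is homogeneous of degree `z ∈ ℤ`; in particular `p = 0` if `z < 0`. -/
def IsHomogeneousOfDegree {τ k : Type*} [CommSemiring k] (p : MvPolynomial τ k) (z : ℤ) : Prop :=
  p = 0 ∨ ∃ e : ℕ, (e : ℤ) = z ∧ p.IsHomogeneous e

/-- A sequence `⋯ → F₂ → F₁ → F₀` of finitely generated graded free modules over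
`k[x_t | t ∈ τ]` and homogeneous maps of degree `0`. -/
structure GradedFreeSequence.{w, u, v} (k : Type u) (τ : Type v) [Field k] where
  /-- the homogeneous basis of `F_i` -/
  ι : ℕ → Type w
  finite : ∀ i, Finite (ι i)
  /-- the degrees of the basis elements -/
  deg : ∀ i, ι i → ℤ
  /-- `d i : F_{i+1} → F_i` -/
  d : ∀ i, (ι (i + 1) →₀ MvPolynomial τ k) →ₗ[MvPolynomial τ k] (ι i →₀ MvPolynomial τ k)
  homogeneous : ∀ i b c,
    IsHomogeneousOfDegree (d i (Finsupp.single b 1) c) (deg (i + 1) b - deg i c)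

namespace GradedFreeSequence

variable {k τ : Type*} [Field k]

/-- The sequence is a chain complex. -/
def IsComplex (S : GradedFreeSequence k τ) : Prop :=
  ∀ i, S.d i ∘ₗ S.d (i + 1) = 0

/-- Isomorphisms of sequences (in particular of complexes) of graded modules: homogeneous
isomorphisms of degree `0` that commute with the differentials. -/
structure Iso (S : GradedFreeSequence k τ) (T : GradedFreeSequence k τ) where
  equiv : ∀ i, (S.ι i →₀ MvPolynomial τ k) ≃ₗ[MvPolynomial τ k] (T.ι i →₀ MvPolynomial τ k)
  homogeneous : ∀ i b c,
    IsHomogeneousOfDegree (equiv i (Finsupp.single b 1) c) (S.deg i b - T.deg i c)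
  comm : ∀ i x, T.d i (equiv (i + 1) x) = equiv i (S.d i x)

/-- The sequence `⋯ → S₁ → S₀ → R` obtained from `S` and a homogeneous map `ε : S₀ → R`, with
`R` (generated in degree `0`) in position `0` and `S_i` in position `i + 1`. -/
noncomputable def augment (S : GradedFreeSequence k τ)
    (ε : (S.ι 0 →₀ MvPolynomial τ k) →ₗ[MvPolynomial τ k] MvPolynomial τ k)
    (hε : ∀ b, IsHomogeneousOfDegree (ε (Finsupp.single b 1)) (S.deg 0 b)) :
    GradedFreeSequence k τ where
  ι
    | 0 => PUnit
    | i + 1 => S.ι i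
  finite
    | 0 => inferInstanceAs (Finite PUnit)
    | i + 1 => S.finite i
  deg
    | 0 => fun _ => 0
    | i + 1 => S.deg i
  d
    | 0 => Finsupp.lsingle PUnit.unit ∘ₗ ε
    | i + 1 => S.d i
  homogeneous
    | 0 => fun b c => by simpa using hε b
    | i + 1 => S.homogeneous i

/-- The degree-`t` linear strand: the summand `R(-t-i)^{β_{i,t+i}}` of `F_i` spanned by the basis
elements of degree `t + i`, with the corresponding blocks of the differentials. -/
noncomputable def linearStrand (S : GradedFreeSequence k τ) (t : ℤ) : GradedFreeSequence k τ where
  ι i := {b : S.ι i | S.deg i b = t + i}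
  finite i := haveI := S.finite i; inferInstance
  deg i b := S.deg i b
  d i := Finsupp.lsubtypeDomain {b : S.ι i | S.deg i b = t + i} ∘ₗ S.d i ∘ₗ
    Finsupp.lmapDomain (MvPolynomial τ k) (MvPolynomial τ k) Subtype.val
  homogeneous i b c := by
    have h : ∀ x : S.ι i →₀ MvPolynomial τ k,
        (Finsupp.lsubtypeDomain (R := MvPolynomial τ k) {b : S.ι i | S.deg i b = t + i} x) c
          = x c := fun _ => rfl
    simpa [Finsupp.mapDomain_single, h] using S.homogeneous i b c

end GradedFreeSequence

/-- A minimal graded free resolution `⋯ → F₁ → F₀ → I → 0` of an ideal `I` of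
`R = k[x_t | t ∈ τ]`, the augmentation `ε` being composed with the inclusion `I ⊆ R`. -/
structure MinimalGradedFreeResolution {k τ : Type*} [Field k] (I : Ideal (MvPolynomial τ k))
    extends GradedFreeSequence k τ where
  ε : (ι 0 →₀ MvPolynomial τ k) →ₗ[MvPolynomial τ k] MvPolynomial τ k
  ε_homogeneous : ∀ b, IsHomogeneousOfDegree (ε (Finsupp.single b 1)) (deg 0 b)
  range_ε : LinearMap.range ε = I
  exact_zero : LinearMap.ker ε = LinearMap.range (d 0)
  exact_succ : ∀ i, LinearMap.ker (d i) = LinearMap.range (d (i + 1))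
  /-- the matrix entries of the differentials lie in the ideal generated by the variables -/
  minimal : ∀ i b c, constantCoeff (d i (Finsupp.single b 1) c) = 0

namespace MinimalGradedFreeResolution

variable {k τ : Type*} [Field k] {I : Ideal (MvPolynomial τ k)}

/-- The composite `F_0^lin ⊆ F_0 → I ⊆ R`. -/
noncomputable def strandAugmentation (F : MinimalGradedFreeResolution I) (t : ℤ) :
    ({b : F.ι 0 | F.deg 0 b = t + (0 : ℕ)} →₀ MvPolynomial τ k) →ₗ[MvPolynomial τ k]
      MvPolynomial τ k :=
  F.ε ∘ₗ Finsupp.lmapDomain (MvPolynomial τ k) (MvPolynomial τ k) Subtype.val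

theorem strandAugmentation_homogeneous (F : MinimalGradedFreeResolution I) (t : ℤ)
    (b : {b : F.ι 0 | F.deg 0 b = t + (0 : ℕ)}) :
    IsHomogeneousOfDegree (F.strandAugmentation t (Finsupp.single b 1)) (F.deg 0 b) := by
  simpa [strandAugmentation, Finsupp.mapDomain_single] using F.ε_homogeneous b

/-- The degree-`t` linear strand of a minimal graded free resolution of an ideal `I`, augmented by
`R`: `R` in position `0` and the linear strand `F_i^lin` in position `i + 1`. -/
noncomputable def augmentedLinearStrand (F : MinimalGradedFreeResolution I) (t : ℤ) :
    GradedFreeSequence k τ :=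
  (F.linearStrand t).augment (F.strandAugmentation t) (F.strandAugmentation_homogeneous t)

end MinimalGradedFreeResolution

/-! ### Simplicial complexes on `[m]` -/

/-- `Δ` is `(n-1)`-pure: all its facets have dimension `n - 1`, i.e. `n` vertices. -/
def IsPureOfCard {m : ℕ} (Δ : PreAbstractSimplicialComplex (Fin m)) (n : ℕ) : Prop :=
  ∀ σ, Maximal (· ∈ Δ) σ → σ.card = n

/-- The clique complex of an `(n-1)`-pure simplicial complex `Δ`: a set of at least `n` vertices
is a face iff all its `n`-element subsets are faces of `Δ`; the faces with at most `n`
vertices are those of `Δ`. -/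
def cliqueComplex {m : ℕ} (Δ : PreAbstractSimplicialComplex (Fin m)) (n : ℕ) :
    PreAbstractSimplicialComplex (Fin m) where
  faces := {σ | σ.Nonempty ∧ ∀ ρ ⊆ σ, ρ.Nonempty → ρ.card ≤ n → ρ ∈ Δ}
  isRelLowerSet_faces := fun _ hσ =>
    ⟨hσ.1, fun _ hρ hne => ⟨hne, fun υ hυ => hσ.2 υ (hυ.trans hρ)⟩⟩

/-- `σ = {σ₀ < ⋯ < σ_{ℓ-1}}` is an `i`-nonface of `Δ`: it is not a face, but for some `j` all of
`σ ∖ σ_j, …, σ ∖ σ_{j+i}` are. -/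
def IsNonface {m : ℕ} (Δ : PreAbstractSimplicialComplex (Fin m)) (i : ℕ)
    (σ : Finset (Fin m)) : Prop :=
  σ ∉ Δ ∧ ∃ (j : ℕ) (hj : j + i < σ.card), ∀ (l : ℕ) (hl : l ≤ i),
    σ.erase (σ.orderEmbOfFin rfl ⟨j + l, by omega⟩) ∈ Δ

/-! ### Determinantal facet ideals -/

/-- `k[x_{ij} | 1 ≤ i ≤ n, 1 ≤ j ≤ m]`; the variables are indexed by the lexicographic product,
so that for the order `MonomialOrder.lex` one has `x₁₁ > x₁₂ > ⋯ > x₁ₘ > x₂₁ > ⋯ > xₙₘ`. -/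
abbrev GenericRing (k : Type*) [Field k] (n m : ℕ) : Type _ := MvPolynomial (Fin n ×ₗ Fin m) k

/-- The generic `n × m` matrix. -/
noncomputable def genericMatrix (k : Type*) [Field k] (n m : ℕ) :
    Matrix (Fin n) (Fin m) (GenericRing k n m) :=
  Matrix.of fun i j => X (toLex (i, j))

/-- The maximal minor of the generic matrix on the columns `σ`. -/
noncomputable def maximalMinor (k : Type*) [Field k] {n m : ℕ} (σ : Finset (Fin m))
    (h : σ.card = n) : GenericRing k n m :=
  ((genericMatrix k n m).submatrix id (σ.orderEmbOfFin h)).det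

/-- The `n`-determinantal facet ideal `J_Δ`. -/
noncomputable def determinantalFacetIdeal (k : Type*) [Field k] (n : ℕ) {m : ℕ}
    (Δ : PreAbstractSimplicialComplex (Fin m)) : Ideal (GenericRing k n m) :=
  Ideal.span {p | ∃ (σ : Finset (Fin m)) (h : σ.card = n),
    Maximal (· ∈ Δ) σ ∧ p = maximalMinor k σ h}

/-- The initial ideal with respect to the lexicographic order. -/
noncomputable def lexInitialIdeal {k : Type*} [Field k] {n m : ℕ}
    (J : Ideal (GenericRing k n m)) : Ideal (GenericRing k n m) :=
  Ideal.span (MonomialOrder.lex.leadingTerm '' (J : Set (GenericRing k n m)))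

theorem maximalMinor_isHomogeneous (k : Type*) [Field k] {n m : ℕ} (σ : Finset (Fin m))
    (h : σ.card = n) : (maximalMinor k σ h).IsHomogeneous n := by
  unfold maximalMinor
  rw [Matrix.det_apply]
  refine IsHomogeneous.sum _ _ _ fun π _ => ?_
  have hp : (∏ i, ((genericMatrix k n m).submatrix id (σ.orderEmbOfFin h)) (π i) i).IsHomogeneous
      (∑ _i : Fin n, 1) :=
    IsHomogeneous.prod _ _ _ fun i _ => by
      simpa [genericMatrix] using isHomogeneous_X k _
  rw [Finset.sum_const, Finset.card_univ, Fintype.card_fin, smul_eq_mul, mul_one] at hp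
  rcases Int.units_eq_one_or (Equiv.Perm.sign π) with hs | hs
  · simpa [hs] using hp
  · simpa [hs] using hp.neg

theorem leadingTerm_isHomogeneous {τ k : Type*} [Field k] (o : MonomialOrder τ)
    {p : MvPolynomial τ k} {e : ℕ} (hp : p.IsHomogeneous e) :
    (o.leadingTerm p).IsHomogeneous e := by
  by_cases h : p = 0
  · simpa [h] using isHomogeneous_zero τ k e
  · refine isHomogeneous_monomial _ ?_
    have := hp (o.leadingCoeff_ne_zero_iff.mpr h)
    rwa [Finsupp.degree_eq_weight_one]

/-! ### The generalized sparse Eagon–Northcott complex -/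

/-- The pairs `(a, p)` of a row `a` and a position `p` (both counted from `0`) such that
`(a, I_p)` belongs to the index set `𝓘_<(α, I)`, where `I` has `l` elements. For rows and positions
counted from `1` the condition reads: `α_a > 0`, and `p = a + j` with
`|α_{≤ a-1}| ≤ j ≤ |α_{≤ a}|`. -/
def sparsePairs {n : ℕ} (α : Fin n → ℕ) (l : ℕ) : Finset (Fin n × Fin l) :=
  Finset.univ.filter fun q =>
    0 < α q.1 ∧ (q.1 : ℕ) + ∑ b ∈ Finset.Iio q.1, α b ≤ q.2 ∧
      (q.2 : ℕ) ≤ q.1 + ∑ b ∈ Finset.Iic q.1, α b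

/-- The basis elements `g^{*(α)} ⊗ f_σ` of `C^<_{i+1}(Δ, M) ⊆ D_i(G^*) ⊗ ⋀^{n+i} F`: `σ` is a face
of `Δ` with `n + i` elements and `|α| = i`. -/
@[ext]
structure SparseIndex {m : ℕ} (Δ : PreAbstractSimplicialComplex (Fin m)) (n i : ℕ) where
  α : Fin n → ℕ
  σ : Finset (Fin m)
  mem : σ ∈ Δ
  card_eq : σ.card = n + i
  sum_eq : ∑ a, α a = i

namespace SparseIndex

variable {m n i : ℕ} {Δ : PreAbstractSimplicialComplex (Fin m)}

instance : Finite (SparseIndex Δ n i) :=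
  Finite.of_injective
    (fun b : SparseIndex Δ n i =>
      ((⟨b.α, Finset.mem_piAntidiag.mpr ⟨b.sum_eq, by simp⟩⟩, b.σ) :
        {α // α ∈ Finset.piAntidiag (Finset.univ : Finset (Fin n)) i} × Finset (Fin m)))
    (fun b c h => by
      simp only [Prod.mk.injEq, Subtype.mk.injEq] at h
      exact SparseIndex.ext h.1 h.2)

/-- The element `I_p` of `I = σ` in position `p`, counted from `0`. -/
def vertex (b : SparseIndex Δ n i) (p : Fin (n + i)) : Fin m :=
  b.σ.orderEmbOfFin b.card_eq p

theorem vertex_mem (b : SparseIndex Δ n i) (p : Fin (n + i)) : b.vertex p ∈ b.σ :=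
  Finset.orderEmbOfFin_mem _ _ _

/-- `g^{*(α - ε_a)} ⊗ f_{σ ∖ σ_p}`. -/
def face (b : SparseIndex Δ n (i + 1)) (a : Fin n) (ha : 0 < b.α a) (p : Fin (n + (i + 1))) :
    SparseIndex Δ n i where
  α := b.α - Pi.single a 1
  σ := b.σ.erase (b.vertex p)
  mem := by
    have hc : (b.σ.erase (b.vertex p)).card = n + i := by
      rw [Finset.card_erase_of_mem (b.vertex_mem p), b.card_eq]; omega
    refine (Δ.isRelLowerSet_faces b.mem).2 (Finset.erase_subset _ _) ?_
    rw [← Finset.card_pos, hc]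
    have := a.pos
    omega
  card_eq := by
    rw [Finset.card_erase_of_mem (b.vertex_mem p), b.card_eq]; omega
  sum_eq := by
    have h1 : ∀ c, (b.α - Pi.single a 1 : Fin n → ℕ) c + (Pi.single a 1 : Fin n → ℕ) c = b.α c := by
      intro c
      by_cases hc : c = a
      · subst hc
        simp
        omega
      · simp [hc]
    have h2 := b.sum_eq
    rw [← Finset.sum_congr rfl fun c _ => h1 c, Finset.sum_add_distrib] at h2
    simpa using h2

end SparseIndex

/-- The sparse Eagon–Northcott differential `C^<_{i+2}(Δ, M) → C^<_{i+1}(Δ, M)`,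
`g^{*(α)} ⊗ f_I ↦ ∑_{(a, I_p) ∈ 𝓘_<(α, I)} (-1)^{p+1} x_{a I_p} g^{*(α - ε_a)} ⊗ f_{I ∖ I_p}`.
As positions are counted from `0` here, the sign becomes `(-1)^p`. -/
noncomputable def sparseDifferential (k : Type*) [Field k] (n : ℕ) {m : ℕ}
    (Δ : PreAbstractSimplicialComplex (Fin m)) (i : ℕ) :
    (SparseIndex Δ n (i + 1) →₀ GenericRing k n m) →ₗ[GenericRing k n m]
      (SparseIndex Δ n i →₀ GenericRing k n m) :=
  Finsupp.linearCombination (GenericRing k n m) fun b : SparseIndex Δ n (i + 1) =>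
    ∑ q ∈ (sparsePairs b.α (n + (i + 1))).attach,
      Finsupp.single (b.face q.1.1 (Finset.mem_filter.mp q.2).2.1 q.1.2)
        ((-1) ^ (q.1.2 : ℕ) * X (toLex (q.1.1, b.vertex q.1.2)))

/-- The part `⋯ → C^<_2(Δ, M) → C^<_1(Δ, M)` of the generalized sparse Eagon–Northcott complex,
with `C^<_{i+1}(Δ, M)` in position `i` and generated in degree `n + i`. -/
noncomputable def sparseENTail (k : Type*) [Field k] (n : ℕ) {m : ℕ}
    (Δ : PreAbstractSimplicialComplex (Fin m)) : GradedFreeSequence k (Fin n ×ₗ Fin m) where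
  ι i := SparseIndex Δ n i
  finite _ := inferInstance
  deg i _ := n + i
  d i := sparseDifferential k n Δ i
  homogeneous i b c := by
    classical
    refine Or.inr ⟨1, by push_cast; ring, ?_⟩
    simp only [sparseDifferential, Finsupp.linearCombination_single, one_smul,
      Finsupp.finsetSum_apply]
    refine IsHomogeneous.sum _ _ _ fun q _ => ?_
    rw [Finsupp.single_apply]
    split_ifs
    · rcases neg_one_pow_eq_or (GenericRing k n m) (q.1.2 : ℕ) with h | h
      · simpa [h] using isHomogeneous_X k _
      · simpa [h] using (isHomogeneous_X k _).neg
    · exact isHomogeneous_zero _ _ _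

/-- The first differential `C^<_1(Δ, M) → ⋀^n G = R · g₁ ∧ ⋯ ∧ gₙ`, where `⋀^n G` is identified
with `R`: it sends `f_σ` to the initial term of the minor `⋀^n M (f_σ)`. (A basis element
`g^{*(α)} ⊗ f_σ` of `C^<_1(Δ, M)` has `α = 0`.) -/
noncomputable def sparseAugmentation (k : Type*) [Field k] (n : ℕ) {m : ℕ}
    (Δ : PreAbstractSimplicialComplex (Fin m)) :
    (SparseIndex Δ n 0 →₀ GenericRing k n m) →ₗ[GenericRing k n m] GenericRing k n m :=
  Finsupp.linearCombination (GenericRing k n m) fun b : SparseIndex Δ n 0 =>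
    MonomialOrder.lex.leadingTerm (maximalMinor (n := n) k b.σ b.card_eq)

theorem sparseAugmentation_homogeneous (k : Type*) [Field k] (n : ℕ) {m : ℕ}
    (Δ : PreAbstractSimplicialComplex (Fin m)) (b : SparseIndex Δ n 0) :
    IsHomogeneousOfDegree (sparseAugmentation k n Δ (Finsupp.single b 1)) (n + (0 : ℕ)) := by
  refine Or.inr ⟨n, by simp, ?_⟩
  rw [sparseAugmentation, Finsupp.linearCombination_single, one_smul]
  exact leadingTerm_isHomogeneous _ (maximalMinor_isHomogeneous k b.σ b.card_eq)

/-- The generalized sparse Eagon–Northcott complex `C^<_•(Δ, M)`. -/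
noncomputable def sparseEagonNorthcott (k : Type*) [Field k] (n : ℕ) {m : ℕ}
    (Δ : PreAbstractSimplicialComplex (Fin m)) : GradedFreeSequence k (Fin n ×ₗ Fin m) :=
  (sparseENTail k n Δ).augment (sparseAugmentation k n Δ) (sparseAugmentation_homogeneous k n Δ)

/-! Call an element of a free module constant if its coordinates lie in `k`. For both complexes,
the differentials are injective on constants, and from position `2` on the entries of the matrices
are linear forms. Moreover each cycle with linear coordinates is the boundary of a constant. So the
boundaries of the constants in position `i + 2` are the linear cycles in position `i + 1`, and an
isomorphism in positions `≤ i + 1` extends uniquely to position `i + 2`. It remains to compare the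
images of the constants under the augmentations, that is, the degree `n` part of the initial ideal
and the span of the leading terms of the generators. These agree because the leading term of a
maximal minor, the product of its diagonal, does not occur in any other maximal minor.

The basis elements `g^{*(α)} ⊗ f_σ` correspond to sets of variables: those in which the `a`-th block
of `σ`, with `α_a + 1` elements, is put into row `a`. Under this identification the differential of
the sparse Eagon–Northcott complex is a restriction of a Koszul differential, whence it squares to
zero, and a linear cycle `y` satisfies the relations between the coefficients of its entries that
hold for a Koszul cycle. These relations determine a constant with boundary `y`, as long as `y`
does not involve `x_s` at a cell `U` for which `U ∪ {s}` is not a cell. The absence of `1`-nonfaces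
guarantees the latter: if `U ∪ {s}` becomes a cell on removing `s`, and on removing other suitable
points, then two of the removed points are consecutive, and so `U ∪ {s}` is a cell. -/

/-! ### Vectors with constant entries -/

/-- The inclusion `k^ι → R^ι` of the vectors with entries in `k` into the free module on `ι` over
a `k`-algebra `R`. -/
noncomputable def constVec {k : Type*} (R : Type*) {ι : Type*} [CommSemiring k] [CommSemiring R]
    [Algebra k R] : (ι →₀ k) →ₗ[k] (ι →₀ R) :=
  Finsupp.mapRange.linearMap (Algebra.linearMap k R)

section ExtendScalars

variable {k R ι κ : Type*} [CommSemiring k] [CommSemiring R] [Algebra k R]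

@[simp]
theorem constVec_apply (x : ι →₀ k) (b : ι) : constVec R x b = algebraMap k R (x b) := rfl

@[simp]
theorem constVec_single (b : ι) (r : k) :
    constVec R (Finsupp.single b r) = Finsupp.single b (algebraMap k R r) :=
  Finsupp.mapRange_single (hf := map_zero _)

theorem constVec_mapDomain (f : ι → κ) (x : ι →₀ k) :
    constVec R (x.mapDomain f) = (constVec R x).mapDomain f :=
  (Finsupp.mapDomain_mapRange f x _ (map_zero _) (map_add (algebraMap k R))).symm

open Classical in
theorem constVec_eq_finsuppScalarRight (x : ι →₀ k) :
    constVec R x = TensorProduct.finsuppScalarRight k R R ι (1 ⊗ₜ[k] x) := by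
  ext b
  simp [TensorProduct.finsuppScalarRight_apply_tmul_apply, Algebra.algebraMap_eq_smul_one]

open Classical in
/-- The `R`-linear isomorphism of free modules with the same matrix as a given `k`-linear one. -/
noncomputable def extendScalars (R : Type*) [CommSemiring R] [Algebra k R]
    (e : (ι →₀ k) ≃ₗ[k] (κ →₀ k)) : (ι →₀ R) ≃ₗ[R] (κ →₀ R) :=
  (TensorProduct.finsuppScalarRight k R R ι).symm ≪≫ₗ e.baseChange k R _ _ ≪≫ₗ
    TensorProduct.finsuppScalarRight k R R κ

@[simp]
theorem extendScalars_constVec (e : (ι →₀ k) ≃ₗ[k] (κ →₀ k)) (x : ι →₀ k) :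
    extendScalars R e (constVec R x) = constVec R (e x) := by
  simp [extendScalars, constVec_eq_finsuppScalarRight]

@[simp]
theorem extendScalars_symm (e : (ι →₀ k) ≃ₗ[k] (κ →₀ k)) :
    (extendScalars R e).symm = extendScalars R e.symm := rfl

theorem extendScalars_apply (e : (ι →₀ k) ≃ₗ[k] (κ →₀ k)) (y : ι →₀ R) :
    extendScalars R e y = y.sum fun b r => r • constVec R (e (Finsupp.single b 1)) := by
  have (b : ι) (r : R) : Finsupp.single b r = r • constVec R (Finsupp.single b (1 : k)) := by simp
  conv_lhs => rw [← y.sum_single]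
  simp only [map_finsuppSum, this, map_smul, extendScalars_constVec]

theorem extendScalars_domLCongr (f : ι ≃ κ) (y : ι →₀ R) :
    extendScalars R (Finsupp.domLCongr f : (ι →₀ k) ≃ₗ[k] (κ →₀ k)) y = y.equivMapDomain f := by
  simp [extendScalars_apply, Finsupp.equivMapDomain_eq_mapDomain, Finsupp.mapDomain]

end ExtendScalars

section Homogeneous

variable {k τ ι κ : Type*} [CommSemiring k]

theorem isHomogeneousOfDegree_natCast {p : MvPolynomial τ k} {e : ℕ} :
    IsHomogeneousOfDegree p e ↔ p.IsHomogeneous e := by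
  refine ⟨?_, fun h => Or.inr ⟨e, rfl, h⟩⟩
  rintro (rfl | ⟨d, hd, h⟩)
  · exact isHomogeneous_zero _ _ _
  · rwa [← Nat.cast_injective hd]

theorem isHomogeneous_extendScalars (e : (ι →₀ k) ≃ₗ[k] (κ →₀ k))
    {y : ι →₀ MvPolynomial τ k} {d : ℕ} (hy : ∀ b, (y b).IsHomogeneous d) (c : κ) :
    (extendScalars (MvPolynomial τ k) e y c).IsHomogeneous d := by
  rw [extendScalars_apply, Finsupp.sum, Finsupp.finsetSum_apply]
  refine IsHomogeneous.sum _ _ _ fun b _ => ?_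
  simpa using (hy b).mul (isHomogeneous_C τ (e (Finsupp.single b 1) c))

theorem isHomogeneous_map_constVec
    {f : (ι →₀ MvPolynomial τ k) →ₗ[MvPolynomial τ k] MvPolynomial τ k} {d : ℕ}
    (hf : ∀ b, (f (Finsupp.single b 1)).IsHomogeneous d) (x : ι →₀ k) :
    (f (constVec _ x)).IsHomogeneous d := by
  induction x using Finsupp.induction_linear with
  | zero => simpa using isHomogeneous_zero τ k d
  | add x y hx hy => simpa using hx.add hy
  | single b r =>
    have h : f (constVec _ (Finsupp.single b r)) = C r * f (Finsupp.single b 1) := by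
      rw [← smul_eq_mul, ← map_smul, constVec_single, Finsupp.smul_single_one, algebraMap_eq]
    rw [h]
    exact (zero_add d) ▸ (isHomogeneous_C τ r).mul (hf b)

theorem eq_C_of_isHomogeneous_zero {p : MvPolynomial τ k} (h : p.IsHomogeneous 0) :
    p = C (coeff 0 p) :=
  totalDegree_eq_zero_iff_eq_C.mp (Nat.le_zero.mp h.totalDegree_le)

/-- The constant terms of the entries of a vector at the basis elements of degree `D`. -/
noncomputable def constPart (deg : ι → ℤ) (D : ℤ) :
    (ι →₀ MvPolynomial τ k) →ₗ[k] ({b : ι | deg b = D} →₀ k) :=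
  Finsupp.lsubtypeDomain _ ∘ₗ Finsupp.mapRange.linearMap (lcoeff k 0)

theorem homogeneousComponent_mul_of_isHomogeneous (w : MvPolynomial τ k) {h : MvPolynomial τ k}
    {e d : ℕ} (hh : h.IsHomogeneous e) (hde : d ≤ e) :
    homogeneousComponent d (w * h) = if d = e then C (coeff 0 w) * h else 0 := by
  conv_lhs => rw [← sum_homogeneousComponent w, Finset.sum_mul, map_sum]
  rw [Finset.sum_eq_single_of_mem 0 (by simp)]
  · rw [homogeneousComponent_of_mem ((homogeneousComponent_isHomogeneous 0 w).mul hh),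
      homogeneousComponent_zero, zero_add]
  · intro j _ hj
    rw [homogeneousComponent_of_mem ((homogeneousComponent_isHomogeneous j w).mul hh)]
    exact if_neg (by lia)

theorem mapDomain_constVec_constPart_apply (deg : ι → ℤ) (D : ℤ) (w : ι →₀ MvPolynomial τ k)
    (b : ι) :
    (constVec (MvPolynomial τ k) (constPart deg D w)).mapDomain Subtype.val b =
      if deg b = D then C (coeff 0 (w b)) else 0 := by
  split_ifs with hb
  · exact Finsupp.mapDomain_apply Subtype.val_injective _ (⟨b, hb⟩ : {b : ι | deg b = D})
  · exact Finsupp.mapDomain_of_notMem_range _ _ (by simpa using hb)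

theorem map_constVec_constPart {deg : ι → ℤ} {D t : ℤ} {d : ℕ} (hd : (d : ℤ) = D - t)
    (hD : ∀ b, D ≤ deg b) {f : (ι →₀ MvPolynomial τ k) →ₗ[MvPolynomial τ k] MvPolynomial τ k}
    (hf : ∀ b, IsHomogeneousOfDegree (f (Finsupp.single b 1)) (deg b - t))
    (w : ι →₀ MvPolynomial τ k) :
    f ((constVec _ (constPart deg D w)).mapDomain Subtype.val) =
      homogeneousComponent d (f w) := by
  induction w using Finsupp.induction_linear with
  | zero => simp
  | add x y hx hy => simp only [map_add, Finsupp.mapDomain_add, hx, hy]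
  | single b r =>
    have hr (s : MvPolynomial τ k) : f (Finsupp.single b s) = s * f (Finsupp.single b 1) := by
      rw [← smul_eq_mul, ← map_smul, Finsupp.smul_single_one]
    have hconst : (constVec (MvPolynomial τ k) (constPart deg D (Finsupp.single b r))).mapDomain
        Subtype.val = Finsupp.single b (if deg b = D then C (coeff 0 r) else 0) := by
      classical
      ext1 c
      rw [mapDomain_constVec_constPart_apply]
      by_cases hc : b = c <;> simp [hc]
    have hbD := hD b
    rw [hconst, hr, hr r]
    rcases hf b with h0 | ⟨e, he, h⟩
    · simp [h0]
    · rw [homogeneousComponent_mul_of_isHomogeneous r h (by lia)]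
      rw [ite_mul, zero_mul]
      exact if_congr (by lia) rfl rfl

end Homogeneous

/-! ### Sequences determined by the image of the last differential -/

theorem exists_linearEquiv_of_range_eq {k U V W : Type*} [Semiring k] [AddCommMonoid U]
    [AddCommMonoid V] [AddCommMonoid W] [Module k U] [Module k V] [Module k W]
    {f : U →ₗ[k] W} {g : V →ₗ[k] W} (hf : Function.Injective f) (hg : Function.Injective g)
    (h : LinearMap.range f = LinearMap.range g) : ∃ e : U ≃ₗ[k] V, ∀ x, g (e x) = f x :=
  ⟨LinearEquiv.ofInjective f hf ≪≫ₗ LinearEquiv.ofEq _ _ h ≪≫ₗ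
    (LinearEquiv.ofInjective g hg).symm, fun x => by simp⟩

namespace GradedFreeSequence

variable {k τ : Type*} [Field k]

/-- No nonzero vector of constants is a cycle, all differentials except possibly the last one have
linear entries, and the cycles with linear entries are the boundaries of vectors of constants.
Augmented linear strands of minimal resolutions have this property, and a sequence with it is
determined by the image of the vectors of constants under the last differential. -/
structure IsLinearStrand (A : GradedFreeSequence k τ) : Prop where
  injective : ∀ i (x : A.ι (i + 1) →₀ k), A.d i (constVec _ x) = 0 → x = 0
  linear : ∀ i b c, (A.d (i + 1) (Finsupp.single b 1) c).IsHomogeneous 1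
  isComplex : A.IsComplex
  exact : ∀ i y, (∀ b, (y b).IsHomogeneous 1) → A.d i y = 0 →
    ∃ x : A.ι (i + 1 + 1) →₀ k, A.d (i + 1) (constVec _ x) = y

/-- The differential restricted to the vectors of constants. -/
noncomputable def constD (A : GradedFreeSequence k τ) (i : ℕ) :
    (A.ι (i + 1) →₀ k) →ₗ[k] (A.ι i →₀ MvPolynomial τ k) :=
  (A.d i).restrictScalars k ∘ₗ constVec _

variable {A B : GradedFreeSequence k τ}

theorem IsComplex.d_d (hA : A.IsComplex) (i : ℕ) (x : A.ι (i + 1 + 1) →₀ MvPolynomial τ k) :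
    A.d i (A.d (i + 1) x) = 0 :=
  LinearMap.congr_fun (hA i) x

theorem IsLinearStrand.constD_injective (hA : A.IsLinearStrand) (i : ℕ) :
    Function.Injective (A.constD i) :=
  (injective_iff_map_eq_zero _).mpr (hA.injective i)

theorem IsLinearStrand.mem_range_constD_succ (hA : A.IsLinearStrand) {i : ℕ}
    {y : A.ι (i + 1) →₀ MvPolynomial τ k} :
    y ∈ LinearMap.range (A.constD (i + 1)) ↔ (∀ b, (y b).IsHomogeneous 1) ∧ A.d i y = 0 := by
  refine ⟨?_, fun ⟨hy, h⟩ => hA.exact i y hy h⟩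
  rintro ⟨x, rfl⟩
  exact ⟨fun b => isHomogeneous_map_constVec (f := Finsupp.lapply b ∘ₗ A.d (i + 1))
    (fun c => hA.linear i c b) x, hA.isComplex.d_d i _⟩

theorem exists_extendScalars_comm (hA : A.IsLinearStrand) (hB : B.IsLinearStrand) {i : ℕ}
    {e : (A.ι i →₀ k) ≃ₗ[k] (B.ι i →₀ k)}
    (he : ∀ y, extendScalars (MvPolynomial τ k) e y ∈ LinearMap.range (B.constD i) ↔
      y ∈ LinearMap.range (A.constD i)) :
    ∃ e' : (A.ι (i + 1) →₀ k) ≃ₗ[k] (B.ι (i + 1) →₀ k),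
      ∀ x, B.d i (extendScalars _ e' x) = extendScalars _ e (A.d i x) := by
  set E := (extendScalars (MvPolynomial τ k) e).restrictScalars k with hE
  have hrange : LinearMap.range (A.constD i) = (LinearMap.range (B.constD i)).comap E.toLinearMap :=
    Submodule.ext fun y => (he y).symm
  obtain ⟨e', he'⟩ := exists_linearEquiv_of_range_eq (f := E.toLinearMap ∘ₗ A.constD i)
    (E.injective.comp (hA.constD_injective i)) (hB.constD_injective i) <| by
      rw [LinearMap.range_comp, hrange]
      exact Submodule.map_comap_eq_of_surjective E.surjective _
  refine ⟨e', LinearMap.congr_fun (f := B.d i ∘ₗ (extendScalars _ e').toLinearMap)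
    (g := (extendScalars _ e).toLinearMap ∘ₗ A.d i) ?_⟩
  refine Finsupp.lhom_ext' fun b => LinearMap.ext_ring ?_
  simpa [constD, ← extendScalars_constVec, hE] using he' (Finsupp.single b 1)

theorem extendScalars_mem_range_constD_succ (hA : A.IsLinearStrand) (hB : B.IsLinearStrand)
    {i : ℕ} {e : (A.ι i →₀ k) ≃ₗ[k] (B.ι i →₀ k)}
    {e' : (A.ι (i + 1) →₀ k) ≃ₗ[k] (B.ι (i + 1) →₀ k)}
    (hcomm : ∀ x, B.d i (extendScalars _ e' x) = extendScalars _ e (A.d i x))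
    (y : A.ι (i + 1) →₀ MvPolynomial τ k) :
    extendScalars _ e' y ∈ LinearMap.range (B.constD (i + 1)) ↔
      y ∈ LinearMap.range (A.constD (i + 1)) := by
  rw [hA.mem_range_constD_succ, hB.mem_range_constD_succ, hcomm, map_eq_zero_iff _
    (extendScalars _ e).injective]
  refine and_congr_left' ⟨fun h => ?_, isHomogeneous_extendScalars e'⟩
  simpa [← extendScalars_symm] using isHomogeneous_extendScalars e'.symm h

theorem IsLinearStrand.nonempty_iso (hA : A.IsLinearStrand) (hB : B.IsLinearStrand)
    (hdeg : ∀ i b c, A.deg i b = B.deg i c) (e : (A.ι 0 →₀ k) ≃ₗ[k] (B.ι 0 →₀ k))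
    (he : ∀ y, extendScalars _ e y ∈ LinearMap.range (B.constD 0) ↔
      y ∈ LinearMap.range (A.constD 0)) :
    Nonempty (A.Iso B) := by
  let P (i : ℕ) : Type _ := {e : (A.ι i →₀ k) ≃ₗ[k] (B.ι i →₀ k) //
    ∀ y, extendScalars _ e y ∈ LinearMap.range (B.constD i) ↔ y ∈ LinearMap.range (A.constD i)}
  have step (i : ℕ) (e : P i) : ∃ e' : P (i + 1), ∀ x,
      B.d i (extendScalars _ e'.1 x) = extendScalars _ e.1 (A.d i x) := by
    obtain ⟨e', hcomm⟩ := exists_extendScalars_comm hA hB e.2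
    exact ⟨⟨e', extendScalars_mem_range_constD_succ hA hB hcomm⟩, hcomm⟩
  choose next hnext using step
  let s (i : ℕ) : P i := Nat.rec ⟨e, he⟩ next i
  exact ⟨{
    equiv i := extendScalars _ (s i).1
    homogeneous i b c := by
      rw [hdeg i b c, sub_self, ← Nat.cast_zero, isHomogeneousOfDegree_natCast]
      simpa [extendScalars_apply] using isHomogeneous_C τ _
    comm i := hnext i (s i) }⟩

theorem augment_d_zero_eq_zero_iff {S : GradedFreeSequence k τ}
    {ε : (S.ι 0 →₀ MvPolynomial τ k) →ₗ[MvPolynomial τ k] MvPolynomial τ k}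
    (hε : ∀ b, IsHomogeneousOfDegree (ε (Finsupp.single b 1)) (S.deg 0 b))
    {x : S.ι 0 →₀ MvPolynomial τ k} : (S.augment ε hε).d 0 x = 0 ↔ ε x = 0 :=
  Finsupp.single_eq_zero

theorem mem_range_constD_augment_zero {S : GradedFreeSequence k τ}
    {ε : (S.ι 0 →₀ MvPolynomial τ k) →ₗ[MvPolynomial τ k] MvPolynomial τ k}
    (hε : ∀ b, IsHomogeneousOfDegree (ε (Finsupp.single b 1)) (S.deg 0 b))
    {y : PUnit →₀ MvPolynomial τ k} {p : MvPolynomial τ k} (hy : y PUnit.unit = p) :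
    y ∈ LinearMap.range ((S.augment ε hε).constD 0) ↔ ∃ x : S.ι 0 →₀ k, ε (constVec _ x) = p :=
  exists_congr fun _ => (Finsupp.unique_ext_iff (α := PUnit)).trans <|
    iff_of_eq <| congrArg₂ Eq Finsupp.single_eq_same hy

theorem IsLinearStrand.nonempty_iso_augment {S T : GradedFreeSequence k τ}
    {ε : (S.ι 0 →₀ MvPolynomial τ k) →ₗ[MvPolynomial τ k] MvPolynomial τ k}
    {η : (T.ι 0 →₀ MvPolynomial τ k) →ₗ[MvPolynomial τ k] MvPolynomial τ k}
    {hε : ∀ b, IsHomogeneousOfDegree (ε (Finsupp.single b 1)) (S.deg 0 b)}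
    {hη : ∀ b, IsHomogeneousOfDegree (η (Finsupp.single b 1)) (T.deg 0 b)}
    (hS : (S.augment ε hε).IsLinearStrand) (hT : (T.augment η hη).IsLinearStrand)
    (hdeg : ∀ i b c, S.deg i b = T.deg i c)
    (h : ∀ p, (∃ x : S.ι 0 →₀ k, ε (constVec _ x) = p) ↔ ∃ x : T.ι 0 →₀ k, η (constVec _ x) = p) :
    Nonempty ((S.augment ε hε).Iso (T.augment η hη)) := by
  let e : (PUnit →₀ k) ≃ₗ[k] (PUnit →₀ k) := Finsupp.domLCongr Equiv.punitEquivPUnit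
  have he (y : PUnit →₀ MvPolynomial τ k) : extendScalars _ e y PUnit.unit = y PUnit.unit := by
    rw [extendScalars_domLCongr]
    rfl
  refine hS.nonempty_iso hT ?_ e fun y => ?_
  · rintro (_ | i) b c
    exacts [rfl, hdeg i b c]
  · exact (mem_range_constD_augment_zero hη (he y)).trans <|
      (h _).symm.trans (mem_range_constD_augment_zero hε rfl).symm

end GradedFreeSequence

/-! ### The linear strand of a minimal resolution -/

namespace GradedFreeSequence

variable {k τ : Type*} [Field k] (S : GradedFreeSequence k τ)

/-- The inclusion of the `i`-th module of the degree-`t` linear strand into that of `S`. -/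
noncomputable def strandInclusion (t : ℤ) (i : ℕ) :
    ({b : S.ι i | S.deg i b = t + i} →₀ MvPolynomial τ k) →ₗ[MvPolynomial τ k]
      (S.ι i →₀ MvPolynomial τ k) :=
  Finsupp.lmapDomain (MvPolynomial τ k) (MvPolynomial τ k) Subtype.val

theorem strandInclusion_apply_coe {t : ℤ} {i : ℕ}
    (x : {b : S.ι i | S.deg i b = t + i} →₀ MvPolynomial τ k)
    (b : {b : S.ι i | S.deg i b = t + i}) : S.strandInclusion t i x b = x b :=
  Finsupp.mapDomain_apply Subtype.val_injective _ _

theorem strandInclusion_injective (t : ℤ) (i : ℕ) :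
    Function.Injective (S.strandInclusion t i) :=
  Finsupp.mapDomain_injective Subtype.val_injective

theorem isHomogeneous_linearStrand_d (t : ℤ) (i : ℕ) (b : (S.linearStrand t).ι (i + 1))
    (c : (S.linearStrand t).ι i) :
    ((S.linearStrand t).d i (Finsupp.single b 1) c).IsHomogeneous 1 := by
  have h : (S.linearStrand t).deg (i + 1) b - (S.linearStrand t).deg i c = (1 : ℕ) := by
    have hb : (S.linearStrand t).deg (i + 1) b = t + (i + 1 : ℕ) := b.2
    have hc : (S.linearStrand t).deg i c = t + i := c.2
    push_cast at hb ⊢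
    lia
  rw [← isHomogeneousOfDegree_natCast, ← h]
  exact (S.linearStrand t).homogeneous i b c

end GradedFreeSequence

namespace MinimalGradedFreeResolution

variable {k τ : Type*} [Field k] {I : Ideal (MvPolynomial τ k)}
  (F : MinimalGradedFreeResolution I)

theorem constantCoeff_d (i : ℕ) (w : F.ι (i + 1) →₀ MvPolynomial τ k) (c : F.ι i) :
    constantCoeff (F.d i w c) = 0 := by
  induction w using Finsupp.induction_linear with
  | zero => simp
  | add v w hv hw => simp [hv, hw]
  | single b r =>
    rw [← mul_one r, ← smul_eq_mul, ← Finsupp.smul_single, map_smul]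
    simp [F.minimal]

theorem eq_zero_of_constVec_mem_range_d {i : ℕ} {x : F.ι i →₀ k}
    (h : constVec _ x ∈ LinearMap.range (F.d i)) : x = 0 := by
  obtain ⟨w, hw⟩ := h
  ext c
  simpa [hw] using F.constantCoeff_d i w c

theorem single_notMem_range_d {i : ℕ} (b : F.ι i) :
    Finsupp.single b 1 ∉ LinearMap.range (F.d i) := fun h => by
  simpa using F.eq_zero_of_constVec_mem_range_d (x := Finsupp.single b 1) (by simpa using h)

theorem ε_single_ne_zero (b : F.ι 0) : F.ε (Finsupp.single b 1) ≠ 0 :=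
  fun h => F.single_notMem_range_d b (F.exact_zero.le h)

theorem d_single_ne_zero {i : ℕ} (b : F.ι (i + 1)) : F.d i (Finsupp.single b 1) ≠ 0 :=
  fun h => F.single_notMem_range_d b ((F.exact_succ i).le h)

theorem d_single_apply_eq_zero {i : ℕ} {b : F.ι (i + 1)} {c : F.ι i}
    (h : F.deg (i + 1) b ≤ F.deg i c) : F.d i (Finsupp.single b 1) c = 0 := by
  rcases F.homogeneous i b c with h0 | ⟨e, he, hd⟩
  · exact h0
  · obtain rfl : e = 0 := by lia
    rw [eq_C_of_isHomogeneous_zero hd, ← constantCoeff_eq, F.minimal, map_zero]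

theorem isComplex : F.IsComplex :=
  fun i => LinearMap.range_le_ker_iff.mp (F.exact_succ i).ge

theorem ε_d (x : F.ι 1 →₀ MvPolynomial τ k) : F.ε (F.d 0 x) = 0 :=
  F.exact_zero.ge ⟨x, rfl⟩

theorem eq_zero_of_strandInclusion_mem_range {t : ℤ} {i : ℕ}
    {x : {b : F.ι i | F.deg i b = t + i} →₀ k}
    (h : F.strandInclusion t i (constVec (MvPolynomial τ k) x) ∈ LinearMap.range (F.d i)) :
    x = 0 := by
  refine Finsupp.mapDomain_injective Subtype.val_injective ?_
  rw [Finsupp.mapDomain_zero]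
  refine F.eq_zero_of_constVec_mem_range_d (i := i) ?_
  rwa [constVec_mapDomain]

variable {F} {n : ℕ}

theorem augmentedLinearStrand_d_zero_eq_zero_iff
    {x : {b : F.ι 0 | F.deg 0 b = n + (0 : ℕ)} →₀ MvPolynomial τ k} :
    (F.augmentedLinearStrand n).d 0 x = 0 ↔ F.ε (F.strandInclusion n 0 x) = 0 :=
  GradedFreeSequence.augment_d_zero_eq_zero_iff (F.strandAugmentation_homogeneous n)

section InitialDegree

variable (hI : ∀ p ∈ I, p ≠ 0 → ∀ e, p.IsHomogeneous e → n ≤ e)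

include hI

theorem le_deg (i : ℕ) (b : F.ι i) : (n : ℤ) + i ≤ F.deg i b := by
  induction i with
  | zero =>
    rcases F.ε_homogeneous b with h | ⟨e, he, h⟩
    · exact absurd h (F.ε_single_ne_zero b)
    · have := hI _ (F.range_ε.le ⟨_, rfl⟩) (F.ε_single_ne_zero b) e h
      lia
  | succ i ih =>
    obtain ⟨c, hc⟩ := Finsupp.ne_iff.mp (F.d_single_ne_zero b)
    have hlt : F.deg i c < F.deg (i + 1) b := lt_of_not_ge (mt F.d_single_apply_eq_zero hc)
    have := ih c
    lia

theorem strandInclusion_linearStrand_d {i : ℕ}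
    (x : {b : F.ι (i + 1) | F.deg (i + 1) b = n + (i + 1 : ℕ)} →₀ MvPolynomial τ k) :
    F.strandInclusion n i ((F.linearStrand n).d i x) = F.d i (F.strandInclusion n (i + 1) x) := by
  ext1 c
  by_cases hc : F.deg i c = n + i
  · exact F.strandInclusion_apply_coe _ ⟨c, hc⟩
  have hzero : Finsupp.lapply c ∘ₗ F.d i ∘ₗ F.strandInclusion n (i + 1) = 0 := by
    refine Finsupp.lhom_ext' fun b => LinearMap.ext_ring ?_
    have hb : F.deg (i + 1) b = n + (i + 1 : ℕ) := b.2
    have hcn := F.le_deg hI i c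
    simpa [GradedFreeSequence.strandInclusion, Finsupp.mapDomain_single] using
      F.d_single_apply_eq_zero (b := b) (c := c) (by push_cast at hb; lia)
  exact (Finsupp.mapDomain_of_notMem_range _ _ (by simpa using hc)).trans
    (LinearMap.congr_fun hzero x).symm

theorem exists_linearStrand_d_constVec_eq {i : ℕ}
    {y : {b : F.ι i | F.deg i b = n + i} →₀ MvPolynomial τ k} (hy : ∀ b, (y b).IsHomogeneous 1)
    (h : F.strandInclusion n i y ∈ LinearMap.range (F.d i)) :
    ∃ x : {b : F.ι (i + 1) | F.deg (i + 1) b = n + (i + 1 : ℕ)} →₀ k,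
      (F.linearStrand n).d i (constVec _ x) = y := by
  obtain ⟨w, hw⟩ := h
  refine ⟨constPart (F.deg (i + 1)) (n + (i + 1 : ℕ)) w,
    Finsupp.ext fun c : {b : F.ι i | F.deg i b = n + i} => ?_⟩
  have hc : F.deg i c = n + i := c.2
  have hwc : F.d i w c = y c := by rw [hw, GradedFreeSequence.strandInclusion_apply_coe]
  calc (F.linearStrand n).d i (constVec _ _) c
      = homogeneousComponent 1 (F.d i w c) :=
        map_constVec_constPart (f := Finsupp.lapply c.1 ∘ₗ F.d i) (t := F.deg i c)
          (by push_cast; lia) (le_deg hI (i + 1)) (fun b => F.homogeneous i b c) w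
    _ = y c := by rw [hwc, homogeneousComponent_of_mem (hy c), if_pos rfl]

theorem exists_strandAugmentation_constVec_eq_iff {p : MvPolynomial τ k} :
    (∃ x : {b : F.ι 0 | F.deg 0 b = n + (0 : ℕ)} →₀ k,
      F.strandAugmentation n (constVec _ x) = p) ↔ p ∈ I ∧ p.IsHomogeneous n := by
  constructor
  · rintro ⟨x, rfl⟩
    refine ⟨F.range_ε.le ⟨_, rfl⟩, isHomogeneous_map_constVec (fun b => ?_) x⟩
    have hb : F.deg 0 b = n := by simpa only [Nat.cast_zero, add_zero] using b.2.out
    rw [← isHomogeneousOfDegree_natCast]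
    simpa only [hb] using F.strandAugmentation_homogeneous n b
  · rintro ⟨hp, hpn⟩
    obtain ⟨w, rfl⟩ := F.range_ε.ge hp
    refine ⟨constPart (F.deg 0) (n + (0 : ℕ)) w, ?_⟩
    have hw := map_constVec_constPart (f := F.ε) (t := 0) (d := n) (by simp) (le_deg hI 0)
      (fun b => by simpa using F.ε_homogeneous b) w
    exact hw.trans ((homogeneousComponent_of_mem hpn).trans (if_pos rfl))

theorem strandInclusion_mem_range_d_of_linearStrand_d_eq_zero {i : ℕ}
    {y : {b : F.ι (i + 1) | F.deg (i + 1) b = n + (i + 1 : ℕ)} →₀ MvPolynomial τ k}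
    (hy : (F.linearStrand n).d i y = 0) :
    F.strandInclusion n (i + 1) y ∈ LinearMap.range (F.d (i + 1)) := by
  rw [← F.exact_succ, LinearMap.mem_ker, ← strandInclusion_linearStrand_d hI, hy]
  exact map_zero _

theorem isComplex_linearStrand : (F.linearStrand n).IsComplex := fun i =>
  LinearMap.ext fun x => F.strandInclusion_injective n i <|
    (strandInclusion_linearStrand_d hI _).trans <|
      (congrArg (F.d i) (strandInclusion_linearStrand_d hI x)).trans <|
        (F.isComplex.d_d i _).trans (map_zero _).symm

theorem isLinearStrand_augmentedLinearStrand : (F.augmentedLinearStrand n).IsLinearStrand where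
  injective
    | 0 => fun _ h => F.eq_zero_of_strandInclusion_mem_range <| F.exact_zero.le <|
        augmentedLinearStrand_d_zero_eq_zero_iff.mp h
    | _ + 1 => fun _ h => F.eq_zero_of_strandInclusion_mem_range <|
        strandInclusion_mem_range_d_of_linearStrand_d_eq_zero hI h
  linear := F.isHomogeneous_linearStrand_d n
  isComplex
    | 0 => LinearMap.ext fun x =>
        augmentedLinearStrand_d_zero_eq_zero_iff.mpr <|
          (congrArg F.ε (strandInclusion_linearStrand_d hI x)).trans (F.ε_d _)
    | i + 1 => isComplex_linearStrand hI i
  exact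
    | 0 => fun _ hy h => exists_linearStrand_d_constVec_eq hI hy <| F.exact_zero.le <|
        augmentedLinearStrand_d_zero_eq_zero_iff.mp h
    | _ + 1 => fun _ hy h => exists_linearStrand_d_constVec_eq hI hy <|
        strandInclusion_mem_range_d_of_linearStrand_d_eq_zero hI h

end InitialDegree

end MinimalGradedFreeResolution

/-! ### Initial ideals of ideals generated in one degree -/

section InitialIdeal

variable {k τ : Type*} [Field k] {S : Set (MvPolynomial τ k)} {n : ℕ}

theorem homogeneousComponent_eq_zero_of_mem_ideal_span (hS : ∀ p ∈ S, p.IsHomogeneous n)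
    {q : MvPolynomial τ k} (hq : q ∈ Ideal.span S) {e : ℕ} (he : e < n) :
    homogeneousComponent e q = 0 := by
  induction hq using Submodule.closure_induction with
  | zero => exact map_zero _
  | add p q _ _ hp hq => rw [map_add, hp, hq, add_zero]
  | smul_mem a p hp =>
    rw [smul_eq_mul, homogeneousComponent_mul_of_isHomogeneous a (hS p hp) he.le, if_neg he.ne]

theorem homogeneousComponent_mem_span_of_mem_ideal_span (hS : ∀ p ∈ S, p.IsHomogeneous n)
    {q : MvPolynomial τ k} (hq : q ∈ Ideal.span S) :
    homogeneousComponent n q ∈ Submodule.span k S := by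
  induction hq using Submodule.closure_induction with
  | zero => simp
  | add p q _ _ hp hq => exact (map_add (homogeneousComponent n) p q).symm ▸ add_mem hp hq
  | smul_mem a p hp =>
    rw [smul_eq_mul, homogeneousComponent_mul_of_isHomogeneous a (hS p hp) le_rfl, if_pos rfl,
      ← smul_eq_C_mul]
    exact Submodule.smul_mem _ _ (Submodule.subset_span hp)

theorem coeff_degree_homogeneousComponent (p : MvPolynomial τ k) (u : τ →₀ ℕ) :
    coeff u (homogeneousComponent u.degree p) = coeff u p := by
  rw [coeff_homogeneousComponent, if_pos rfl]

theorem le_degree_of_mem_support_of_mem_ideal_span (hS : ∀ p ∈ S, p.IsHomogeneous n)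
    {q : MvPolynomial τ k} (hq : q ∈ Ideal.span S) {u : τ →₀ ℕ} (hu : u ∈ q.support) :
    n ≤ u.degree := by
  by_contra! h
  rw [mem_support_iff, ← coeff_degree_homogeneousComponent,
    homogeneousComponent_eq_zero_of_mem_ideal_span hS hq h] at hu
  exact hu (coeff_zero u)

variable {o : MonomialOrder τ}

theorem exists_degree_le_of_mem_span_leadingTerm {B : Set (MvPolynomial τ k)}
    {p : MvPolynomial τ k} (hp : p ∈ Ideal.span (o.leadingTerm '' B)) {u : τ →₀ ℕ}
    (hu : u ∈ p.support) : ∃ q ∈ B, q ≠ 0 ∧ o.degree q ≤ u := by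
  have himage : (fun q => monomial (o.degree q) (1 : k)) '' (B \ {0}) =
      (fun s => monomial s 1) '' (o.degree '' (B \ {0})) := by
    rw [Set.image_image]
  rw [MonomialOrder.span_leadingTerm_eq_span_monomial', himage] at hp
  obtain ⟨_, ⟨q, ⟨hqB, hq0⟩, rfl⟩, hle⟩ := mem_ideal_span_monomial_image.mp hp u hu
  exact ⟨q, hqB, hq0, hle⟩

theorem le_of_mem_span_leadingTerm_ideal_span (hS : ∀ p ∈ S, p.IsHomogeneous n)
    {p : MvPolynomial τ k} (hp : p ∈ Ideal.span (o.leadingTerm '' (Ideal.span S : Set _)))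
    (hp0 : p ≠ 0) {e : ℕ} (he : p.IsHomogeneous e) : n ≤ e := by
  obtain ⟨u, hu⟩ := support_nonempty.mpr hp0
  obtain ⟨q, hq, hq0, hle⟩ := exists_degree_le_of_mem_span_leadingTerm hp hu
  rw [← not_imp_comm.mp he.coeff_eq_zero (mem_support_iff.mp hu)]
  exact (le_degree_of_mem_support_of_mem_ideal_span hS hq (o.degree_mem_support hq0)).trans
    (Finsupp.degree_mono hle)

theorem degree_homogeneousComponent_degree {q : MvPolynomial τ k} (hq : q ≠ 0) :
    o.degree (homogeneousComponent (o.degree q).degree q) = o.degree q := by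
  refine o.toSyn.injective (le_antisymm (o.degree_le_iff.mpr fun u hu => ?_) ?_)
  · rw [support_homogeneousComponent] at hu
    exact o.le_degree (Finset.mem_filter.mp hu).1
  · refine o.le_degree (mem_support_iff.mpr ?_)
    rw [coeff_degree_homogeneousComponent]
    exact o.coeff_degree_ne_zero_iff.mpr hq

theorem monomial_degree_mem_span_leadingTerm {B : Set (MvPolynomial τ k)} {q : MvPolynomial τ k}
    (hqB : q ∈ B) (hq : q ≠ 0) (a : k) :
    monomial (o.degree q) a ∈ Submodule.span k (o.leadingTerm '' B) := by
  have h : monomial (o.degree q) a = (a / o.leadingCoeff q) • o.leadingTerm q := by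
    rw [MonomialOrder.leadingTerm, smul_monomial, smul_eq_mul,
      div_mul_cancel₀ _ (o.leadingCoeff_ne_zero_iff.mpr hq)]
  exact h ▸ Submodule.smul_mem _ _ (Submodule.subset_span ⟨q, hqB, rfl⟩)

theorem mem_span_leadingTerm_of_isHomogeneous (hS : ∀ p ∈ S, p.IsHomogeneous n)
    {p : MvPolynomial τ k} (hp : p ∈ Ideal.span (o.leadingTerm '' (Ideal.span S : Set _)))
    (hpn : p.IsHomogeneous n) :
    p ∈ Submodule.span k (o.leadingTerm '' (Submodule.span k S : Set _)) := by
  rw [p.as_sum]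
  refine Submodule.sum_mem _ fun u hu => ?_
  obtain ⟨q, hq, hq0, hle⟩ := exists_degree_le_of_mem_span_leadingTerm hp hu
  have hun : u.degree = n := not_imp_comm.mp hpn.coeff_eq_zero (mem_support_iff.mp hu)
  have hqn := le_degree_of_mem_support_of_mem_ideal_span hS hq (o.degree_mem_support hq0)
  obtain ⟨v, rfl⟩ := le_iff_exists_add.mp hle
  rw [map_add] at hun
  obtain rfl : v = 0 := (Finsupp.degree_eq_zero_iff v).mp (by lia)
  rw [map_zero, add_zero] at hun
  have hcomp := degree_homogeneousComponent_degree (o := o) hq0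
  rw [hun] at hcomp
  rw [add_zero, ← hcomp]
  refine monomial_degree_mem_span_leadingTerm
    (homogeneousComponent_mem_span_of_mem_ideal_span hS hq) (fun h => ?_) _
  have hne := o.coeff_degree_ne_zero_iff.mpr hq0
  rw [← coeff_degree_homogeneousComponent, hun, h] at hne
  exact hne (coeff_zero _)

theorem leadingTerm_mem_span_leadingTerm (hS : ∀ p ∈ S, ∀ q ∈ S, p ≠ q → coeff (o.degree p) q = 0)
    {p : MvPolynomial τ k} (hp : p ∈ Submodule.span k S) :
    o.leadingTerm p ∈ Submodule.span k (o.leadingTerm '' S) := by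
  rcases eq_or_ne p 0 with rfl | hp0
  · simp
  obtain ⟨c, hcS, rfl⟩ := Submodule.mem_span_set.mp hp
  have hcoeff (u : τ →₀ ℕ) :
      coeff u (c.sum fun q a => a • q) = ∑ q ∈ c.support, c q * coeff u q := by
    simp [Finsupp.sum, coeff_sum]
  have hlead := o.coeff_degree_ne_zero_iff.mpr hp0
  rw [hcoeff] at hlead
  obtain ⟨q, hqc, hq⟩ := Finset.exists_ne_zero_of_sum_ne_zero hlead
  have hq0 : q ≠ 0 := fun h => by simp [h] at hq
  have hdeg : o.degree (c.sum fun q a => a • q) = o.degree q := by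
    refine o.toSyn.injective (le_antisymm ?_ ?_) <;> refine o.le_degree (mem_support_iff.mpr ?_)
    · exact right_ne_zero_of_mul hq
    · rw [hcoeff, Finset.sum_eq_single_of_mem q hqc fun r hr hrq => by
        rw [hS q (hcS hqc) r (hcS hr) hrq.symm, mul_zero]]
      exact mul_ne_zero (left_ne_zero_of_mul hq) (o.coeff_degree_ne_zero_iff.mpr hq0)
  rw [MonomialOrder.leadingTerm, hdeg]
  exact monomial_degree_mem_span_leadingTerm (hcS hqc) hq0 _

theorem mem_span_leadingTerm_and_isHomogeneous_iff (hS : ∀ p ∈ S, p.IsHomogeneous n)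
    (hlead : ∀ p ∈ S, ∀ q ∈ S, p ≠ q → coeff (o.degree p) q = 0) {p : MvPolynomial τ k} :
    p ∈ Ideal.span (o.leadingTerm '' (Ideal.span S : Set _)) ∧ p.IsHomogeneous n ↔
      p ∈ Submodule.span k (o.leadingTerm '' S) := by
  refine ⟨fun ⟨hp, hpn⟩ => ?_, fun hp => ⟨?_, ?_⟩⟩
  · refine Submodule.span_le.mpr ?_ (mem_span_leadingTerm_of_isHomogeneous hS hp hpn)
    rintro _ ⟨q, hq, rfl⟩
    exact leadingTerm_mem_span_leadingTerm hlead hq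
  · exact Submodule.span_subset_span k (MvPolynomial τ k) _ <|
      Submodule.span_mono (Set.image_mono Ideal.subset_span) hp
  · have hle : Submodule.span k (o.leadingTerm '' S) ≤ homogeneousSubmodule τ k n := by
      refine Submodule.span_le.mpr ?_
      rintro _ ⟨q, hq, rfl⟩
      exact leadingTerm_isHomogeneous o (hS q hq)
    exact hle hp

end InitialIdeal

/-! ### Maximal minors -/

section Minors

variable {n m : ℕ}

/-- The exponent of the term of a maximal minor on the columns `c` that belongs to the
permutation `π`; the diagonal term belongs to `π = 1`. -/
noncomputable def permExponent (c : Fin n → Fin m) (π : Equiv.Perm (Fin n)) :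
    (Fin n ×ₗ Fin m) →₀ ℕ :=
  ∑ i, Finsupp.single (toLex (π i, c i)) 1

theorem permExponent_apply (c : Fin n → Fin m) (π : Equiv.Perm (Fin n)) (r : Fin n) (j : Fin m) :
    permExponent c π (toLex (r, j)) = if c (π.symm r) = j then 1 else 0 := by
  rw [permExponent, Finsupp.finsetSum_apply, Finset.sum_eq_single (π.symm r)]
  · simp [Finsupp.single_apply]
  · intro i _ hi
    rw [Finsupp.single_apply, if_neg]
    rintro ⟨⟩
    simp at hi
  · simp

theorem exists_lt_symm_apply_of_ne_one {π : Equiv.Perm (Fin n)} (hπ : π ≠ 1) :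
    ∃ r, r < π.symm r ∧ ∀ s < r, π.symm s = s := by
  have hne : ∃ r, π.symm r ≠ r := by
    by_contra! h
    exact hπ (Equiv.ext fun r => (π.symm_apply_eq.mp (h r)).symm)
  obtain ⟨r, hr, hmin⟩ := wellFounded_lt.has_min {r | π.symm r ≠ r} hne
  have hfix (s : Fin n) (hs : s < r) : π.symm s = s := not_not.mp fun h => hmin s h hs
  exact ⟨r, lt_of_le_of_ne (le_of_not_gt fun h => hr (π.symm.injective (hfix _ h))) hr.symm, hfix⟩

theorem permExponent_lt {c : Fin n → Fin m} (hc : StrictMono c) {π : Equiv.Perm (Fin n)}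
    (hπ : π ≠ 1) : toLex (permExponent c π) < toLex (permExponent c 1) := by
  obtain ⟨r, hr, hfix⟩ := exists_lt_symm_apply_of_ne_one hπ
  refine Finsupp.Lex.lt_iff.mpr ⟨toLex (r, c r), fun x hx => ?_, ?_⟩
  · obtain ⟨⟨s, j⟩, rfl⟩ := toLex.surjective x
    simp only [ofLex_toLex, permExponent_apply]
    rcases Prod.Lex.toLex_lt_toLex.mp hx with hs | ⟨rfl, hj⟩
    · rw [hfix s hs]
      rfl
    · exact (if_neg (hj.trans (hc hr)).ne').trans (if_neg hj.ne').symm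
  · simp only [ofLex_toLex, permExponent_apply]
    exact ((if_neg (hc hr).ne').trans_lt one_pos).trans_eq (if_pos rfl).symm

/-- The exponent of the diagonal term of the maximal minor on the columns `σ`. -/
noncomputable def diagExponent (σ : Finset (Fin m)) (h : σ.card = n) : (Fin n ×ₗ Fin m) →₀ ℕ :=
  permExponent (σ.orderEmbOfFin h) 1

variable {k : Type*} [Field k]

theorem maximalMinor_eq_sum (σ : Finset (Fin m)) (h : σ.card = n) :
    maximalMinor k σ h = ∑ π : Equiv.Perm (Fin n),
      monomial (permExponent (σ.orderEmbOfFin h) π) ((Equiv.Perm.sign π : ℤ) : k) := by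
  rw [maximalMinor, Matrix.det_apply']
  refine Finset.sum_congr rfl fun π _ => ?_
  have hprod : ∏ i, (genericMatrix k n m).submatrix id (σ.orderEmbOfFin h) (π i) i =
      monomial (permExponent (σ.orderEmbOfFin h) π) (1 : k) := by
    rw [permExponent, monomial_sum_one]
    rfl
  rw [hprod, ← map_intCast (C : k →+* GenericRing k n m), C_mul_monomial, mul_one]

theorem coeff_diagExponent_maximalMinor (σ : Finset (Fin m)) (h : σ.card = n) :
    coeff (diagExponent σ h) (maximalMinor k σ h) = 1 := by
  rw [maximalMinor_eq_sum, coeff_sum, Finset.sum_eq_single 1]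
  · simp [diagExponent]
  · intro π _ hπ
    exact (coeff_monomial _ _ _).trans <| if_neg fun he =>
      (permExponent_lt (σ.orderEmbOfFin h).strictMono hπ).ne (congrArg toLex he)
  · simp

theorem coeff_diagExponent_maximalMinor_of_ne {σ ρ : Finset (Fin m)} (hσ : σ.card = n)
    (hρ : ρ.card = n) (hne : σ ≠ ρ) : coeff (diagExponent σ hσ) (maximalMinor k ρ hρ) = 0 := by
  rw [maximalMinor_eq_sum, coeff_sum]
  refine Finset.sum_eq_zero fun π _ => (coeff_monomial _ _ _).trans <| if_neg fun he => hne ?_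
  have hcol (r : Fin n) : ρ.orderEmbOfFin hρ (π.symm r) = σ.orderEmbOfFin hσ r := by
    have := DFunLike.congr_fun he (toLex (r, σ.orderEmbOfFin hσ r))
    rw [diagExponent, permExponent_apply, permExponent_apply] at this
    simpa [Equiv.symm_apply_eq] using this
  rw [← Finset.coe_inj, ← Finset.range_orderEmbOfFin σ hσ, ← Finset.range_orderEmbOfFin ρ hρ,
    ← π.symm.surjective.range_comp (ρ.orderEmbOfFin hρ)]
  exact congrArg Set.range (funext hcol).symm

theorem lex_degree_maximalMinor (σ : Finset (Fin m)) (h : σ.card = n) :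
    MonomialOrder.lex.degree (maximalMinor k σ h) = diagExponent σ h := by
  refine MonomialOrder.lex.toSyn.injective (le_antisymm ?_ ?_)
  · refine MonomialOrder.lex.degree_le_iff.mpr fun u hu => ?_
    rw [maximalMinor_eq_sum] at hu
    obtain ⟨π, -, hπ⟩ := Finset.mem_biUnion.mp (support_sum hu)
    obtain rfl := Finset.mem_singleton.mp (support_monomial_subset hπ)
    rcases eq_or_ne π 1 with rfl | hπ1
    exacts [le_rfl, (permExponent_lt (σ.orderEmbOfFin h).strictMono hπ1).le]
  · refine MonomialOrder.lex.le_degree (mem_support_iff.mpr ?_)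
    rw [coeff_diagExponent_maximalMinor]
    exact one_ne_zero

theorem lex_leadingTerm_maximalMinor (σ : Finset (Fin m)) (h : σ.card = n) :
    MonomialOrder.lex.leadingTerm (maximalMinor k σ h) = monomial (diagExponent σ h) 1 := by
  rw [MonomialOrder.leadingTerm, MonomialOrder.leadingCoeff, lex_degree_maximalMinor,
    coeff_diagExponent_maximalMinor]

variable {Δ : PreAbstractSimplicialComplex (Fin m)}

theorem le_of_mem_lexInitialIdeal {p : GenericRing k n m}
    (hp : p ∈ lexInitialIdeal (determinantalFacetIdeal k n Δ)) (hp0 : p ≠ 0) {e : ℕ}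
    (he : p.IsHomogeneous e) : n ≤ e := by
  refine le_of_mem_span_leadingTerm_ideal_span ?_ hp hp0 he
  rintro _ ⟨σ, h, -, rfl⟩
  exact maximalMinor_isHomogeneous k σ h

theorem mem_lexInitialIdeal_and_isHomogeneous_iff {p : GenericRing k n m} :
    p ∈ lexInitialIdeal (determinantalFacetIdeal k n Δ) ∧ p.IsHomogeneous n ↔
      p ∈ Submodule.span k (MonomialOrder.lex.leadingTerm ''
        {p | ∃ (σ : Finset (Fin m)) (h : σ.card = n),
          Maximal (· ∈ Δ) σ ∧ p = maximalMinor k σ h}) := by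
  refine mem_span_leadingTerm_and_isHomogeneous_iff ?_ ?_
  · rintro _ ⟨σ, h, -, rfl⟩
    exact maximalMinor_isHomogeneous k σ h
  · rintro _ ⟨σ, hσ, -, rfl⟩ _ ⟨ρ, hρ, -, rfl⟩ hne
    rw [lex_degree_maximalMinor]
    refine coeff_diagExponent_maximalMinor_of_ne hσ hρ fun h => hne ?_
    subst h
    rfl

end Minors

/-! ### Cells -/

section Cells

variable {n m : ℕ}

/-- The row of the variable `x_s`. -/
def rowOf (s : Fin n ×ₗ Fin m) : Fin n := (ofLex s).1

/-- The column of the variable `x_s`. -/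
def colOf (s : Fin n ×ₗ Fin m) : Fin m := (ofLex s).2

theorem eq_of_rowOf_eq_of_colOf_eq {s t : Fin n ×ₗ Fin m} (hr : rowOf s = rowOf t)
    (hc : colOf s = colOf t) : s = t :=
  ofLex.injective (Prod.ext hr hc)

theorem lt_iff_rowOf_colOf {s t : Fin n ×ₗ Fin m} :
    s < t ↔ rowOf s < rowOf t ∨ rowOf s = rowOf t ∧ colOf s < colOf t :=
  Prod.Lex.lt_iff

/-- The columns of the points in a row lie before those of the points in the later rows. -/
def IsStaircase (U : Finset (Fin n ×ₗ Fin m)) : Prop :=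
  ∀ ⦃s⦄, s ∈ U → ∀ ⦃t⦄, t ∈ U → rowOf s < rowOf t → colOf s < colOf t

/-- Every row contains a point of `U`. -/
def MeetsEveryRow (U : Finset (Fin n ×ₗ Fin m)) : Prop :=
  ∀ a, ∃ s ∈ U, rowOf s = a

/-- A staircase with points in every row whose columns form a face of `Γ`. The cells with `n + i`
points encode the basis elements `g^{*(α)} ⊗ f_σ` of `C^<_{i+1}(Γ, M)`: cut `σ` into consecutive
blocks of sizes `α_a + 1`, and put the `a`-th block into row `a`. -/
structure IsCell (Γ : PreAbstractSimplicialComplex (Fin m)) (U : Finset (Fin n ×ₗ Fin m)) :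
    Prop where
  isStaircase : IsStaircase U
  meetsEveryRow : MeetsEveryRow U
  mem : U.image colOf ∈ Γ

theorem IsStaircase.mono {U V : Finset (Fin n ×ₗ Fin m)} (hV : IsStaircase V) (h : U ⊆ V) :
    IsStaircase U :=
  fun _ hs _ ht => hV (h hs) (h ht)

theorem MeetsEveryRow.mono {U V : Finset (Fin n ×ₗ Fin m)} (hU : MeetsEveryRow U) (h : U ⊆ V) :
    MeetsEveryRow V :=
  fun a => let ⟨s, hs, hr⟩ := hU a; ⟨s, h hs, hr⟩

theorem IsCell.of_subset {Γ : PreAbstractSimplicialComplex (Fin m)}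
    {U V : Finset (Fin n ×ₗ Fin m)} (hV : IsCell Γ V) (h : U ⊆ V) (hU : MeetsEveryRow U) :
    IsCell Γ U where
  isStaircase := hV.isStaircase.mono h
  meetsEveryRow := hU
  mem := by
    obtain ⟨v, -⟩ := Finset.image_nonempty.mp (Γ.isRelLowerSet_faces hV.mem).1
    obtain ⟨u, hu, -⟩ := hU (rowOf v)
    exact (Γ.isRelLowerSet_faces hV.mem).2 (Finset.image_subset_image h)
      (Finset.image_nonempty.mpr ⟨u, hu⟩)

theorem MeetsEveryRow.erase {U : Finset (Fin n ×ₗ Fin m)} (hU : MeetsEveryRow U)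
    {s t : Fin n ×ₗ Fin m} (ht : t ∈ U) (hne : t ≠ s) (hr : rowOf t = rowOf s) :
    MeetsEveryRow (U.erase s) := by
  intro a
  obtain ⟨x, hx, rfl⟩ := hU a
  obtain rfl | hxs := eq_or_ne x s
  · exact ⟨t, Finset.mem_erase.mpr ⟨hne, ht⟩, hr⟩
  · exact ⟨x, Finset.mem_erase.mpr ⟨hxs, hx⟩, rfl⟩

namespace IsStaircase

variable {U : Finset (Fin n ×ₗ Fin m)}

theorem strictMonoOn_colOf (hU : IsStaircase U) :
    StrictMonoOn colOf (U : Set (Fin n ×ₗ Fin m)) := by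
  intro s hs t ht h
  rcases lt_iff_rowOf_colOf.mp h with hr | ⟨-, hc⟩
  exacts [hU hs ht hr, hc]

theorem card_image_colOf (hU : IsStaircase U) : (U.image colOf).card = U.card :=
  Finset.card_image_of_injOn hU.strictMonoOn_colOf.injOn

theorem card_filter_colOf_lt (hU : IsStaircase U) {s : Fin n ×ₗ Fin m} (hs : s ∈ U) :
    ((U.image colOf).filter (· < colOf s)).card = (U.filter (· < s)).card := by
  rw [Finset.filter_image, Finset.filter_congr fun t ht => hU.strictMonoOn_colOf.lt_iff_lt ht hs,
    (hU.mono (Finset.filter_subset _ U)).card_image_colOf]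

theorem image_colOf_erase (hU : IsStaircase U) {s : Fin n ×ₗ Fin m} (hs : s ∈ U) :
    (U.erase s).image colOf = (U.image colOf).erase (colOf s) := by
  rw [← Finset.coe_inj]
  push_cast
  rw [hU.strictMonoOn_colOf.injOn.image_sdiff_subset (Set.singleton_subset_iff.mpr hs),
    Set.image_singleton]

end IsStaircase

end Cells

/-! ### Blocks -/

section Blocks

variable {n : ℕ} (α : Fin n → ℕ)

/-- The first position of the `a`-th of consecutive blocks of sizes `α_a + 1`, counted from `0`. -/
def blockStart (a : Fin n) : ℕ := a + ∑ b ∈ Finset.Iio a, α b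

/-- The last position of the `a`-th of consecutive blocks of sizes `α_a + 1`, counted from `0`. -/
def blockEnd (a : Fin n) : ℕ := a + ∑ b ∈ Finset.Iic a, α b

theorem mem_sparsePairs {l : ℕ} {q : Fin n × Fin l} :
    q ∈ sparsePairs α l ↔ 0 < α q.1 ∧ blockStart α q.1 ≤ q.2 ∧ (q.2 : ℕ) ≤ blockEnd α q.1 := by
  simp [sparsePairs, blockStart, blockEnd]

theorem blockEnd_eq (a : Fin n) : blockEnd α a = blockStart α a + α a := by
  rw [blockEnd, blockStart, ← Finset.Iio_insert, Finset.sum_insert (by simp)]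
  ring

theorem blockEnd_lt_blockStart {a b : Fin n} (h : a < b) : blockEnd α a < blockStart α b := by
  rw [blockEnd, blockStart]
  exact add_lt_add_of_lt_of_le h <| Finset.sum_le_sum_of_subset fun c hc =>
    Finset.mem_Iio.mpr ((Finset.mem_Iic.mp hc).trans_lt h)

theorem blockEnd_lt {i : ℕ} (h : ∑ a, α a = i) (a : Fin n) : blockEnd α a < n + i := by
  rw [blockEnd, ← h]
  exact add_lt_add_of_lt_of_le a.2 (Finset.sum_le_sum_of_subset (Finset.subset_univ _))

theorem blockStart_eq_sum (a : Fin n) : blockStart α a = ∑ b ∈ Finset.Iio a, (α b + 1) := by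
  simp [blockStart, Finset.sum_add_distrib, add_comm]

theorem blockEnd_add_one_eq_sum (a : Fin n) :
    blockEnd α a + 1 = ∑ b ∈ Finset.Iic a, (α b + 1) := by
  simp [blockEnd, Finset.sum_add_distrib, add_assoc, add_left_comm]

theorem card_filter_block {i : ℕ} (h : ∑ a, α a = i) (a : Fin n) :
    (Finset.univ.filter fun p : Fin (n + i) =>
      blockStart α a ≤ p ∧ (p : ℕ) ≤ blockEnd α a).card = α a + 1 := by
  have hlt := blockEnd_lt α h a
  have heq := blockEnd_eq α a
  have hIcc : (Finset.univ.filter fun p : Fin (n + i) =>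
      blockStart α a ≤ p ∧ (p : ℕ) ≤ blockEnd α a) =
        Finset.Icc ⟨blockStart α a, by omega⟩ ⟨blockEnd α a, hlt⟩ := by
    ext p
    simp [Fin.le_def]
  rw [hIcc, Fin.card_Icc]
  dsimp only
  omega

end Blocks

/-! ### The cells of the basis elements -/

theorem card_filter_lt_orderEmbOfFin {α : Type*} [LinearOrder α] (σ : Finset α) {l : ℕ}
    (h : σ.card = l) (p : Fin l) : (σ.filter (· < σ.orderEmbOfFin h p)).card = p := by
  have hmap : ((Finset.univ.map (σ.orderEmbOfFin h).toEmbedding).filter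
      (· < σ.orderEmbOfFin h p)).card = p := by
    rw [Finset.filter_map, Finset.card_map, ← Fin.card_Iio p]
    congr 1
    ext q
    simp
  rwa [Finset.map_orderEmbOfFin_univ] at hmap

namespace SparseIndex

variable {m n i : ℕ} {Γ : PreAbstractSimplicialComplex (Fin m)}

/-- The cell encoding a basis element `g^{*(α)} ⊗ f_σ`: its points `(a, σ_p)` are those with `p` in
the `a`-th block. -/
def cell (b : SparseIndex Γ n i) : Finset (Fin n ×ₗ Fin m) :=
  Finset.univ.filter fun s => ∃ p : Fin (n + i), b.vertex p = colOf s ∧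
    blockStart b.α (rowOf s) ≤ p ∧ (p : ℕ) ≤ blockEnd b.α (rowOf s)

theorem mem_cell {b : SparseIndex Γ n i} {s : Fin n ×ₗ Fin m} :
    s ∈ b.cell ↔ ∃ p : Fin (n + i), b.vertex p = colOf s ∧
      blockStart b.α (rowOf s) ≤ p ∧ (p : ℕ) ≤ blockEnd b.α (rowOf s) := by
  simp [cell]

theorem vertex_strictMono (b : SparseIndex Γ n i) : StrictMono b.vertex :=
  (b.σ.orderEmbOfFin b.card_eq).strictMono

theorem isStaircase_cell (b : SparseIndex Γ n i) : IsStaircase b.cell := by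
  intro s hs t ht h
  obtain ⟨p, hp, -, hpEnd⟩ := mem_cell.mp hs
  obtain ⟨q, hq, hqStart, -⟩ := mem_cell.mp ht
  rw [← hp, ← hq]
  exact b.vertex_strictMono (hpEnd.trans_lt ((blockEnd_lt_blockStart _ h).trans_le hqStart))

theorem card_filter_rowOf_cell (b : SparseIndex Γ n i) (a : Fin n) :
    (b.cell.filter (rowOf · = a)).card = b.α a + 1 := by
  have himage : b.cell.filter (rowOf · = a) = (Finset.univ.filter fun p : Fin (n + i) =>
      blockStart b.α a ≤ p ∧ (p : ℕ) ≤ blockEnd b.α a).image fun p => toLex (a, b.vertex p) := by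
    ext s
    simp only [Finset.mem_filter, Finset.mem_image, Finset.mem_univ, true_and, mem_cell]
    constructor
    · rintro ⟨⟨p, hp, hp'⟩, rfl⟩
      exact ⟨p, hp', eq_of_rowOf_eq_of_colOf_eq rfl hp⟩
    · rintro ⟨p, hp, rfl⟩
      exact ⟨⟨p, rfl, hp⟩, rfl⟩
  rw [himage, Finset.card_image_of_injective, card_filter_block _ b.sum_eq]
  exact fun p q h => b.vertex_strictMono.injective (congrArg colOf h)

theorem meetsEveryRow_cell (b : SparseIndex Γ n i) : MeetsEveryRow b.cell := by
  intro a
  have hpos : 0 < (b.cell.filter (rowOf · = a)).card := by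
    rw [b.card_filter_rowOf_cell]
    omega
  obtain ⟨s, hs⟩ := Finset.card_pos.mp hpos
  exact ⟨s, Finset.mem_filter.mp hs⟩

theorem card_cell (b : SparseIndex Γ n i) : b.cell.card = n + i := by
  rw [Finset.card_eq_sum_card_fiberwise (f := rowOf) (t := Finset.univ) (by simp),
    Finset.sum_congr rfl fun a _ => b.card_filter_rowOf_cell a, Finset.sum_add_distrib, b.sum_eq]
  simp [add_comm]

theorem image_colOf_cell (b : SparseIndex Γ n i) : b.cell.image colOf = b.σ := by
  refine Finset.eq_of_subset_of_card_le (Finset.image_subset_iff.mpr fun s hs => ?_) ?_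
  · obtain ⟨p, hp, -⟩ := mem_cell.mp hs
    exact hp ▸ b.vertex_mem p
  · rw [b.isStaircase_cell.card_image_colOf, b.card_cell, b.card_eq]

theorem isCell_cell (b : SparseIndex Γ n i) : IsCell Γ b.cell where
  isStaircase := b.isStaircase_cell
  meetsEveryRow := b.meetsEveryRow_cell
  mem := b.image_colOf_cell ▸ b.mem

theorem cell_injective : Function.Injective (cell : SparseIndex Γ n i → _) := by
  intro b c h
  refine SparseIndex.ext (funext fun a => ?_) ?_
  · have hcard := b.card_filter_rowOf_cell a
    rw [h, c.card_filter_rowOf_cell] at hcard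
    omega
  · rw [← b.image_colOf_cell, h, c.image_colOf_cell]

section

variable {b : SparseIndex Γ n i} {U : Finset (Fin n ×ₗ Fin m)} (hU : IsStaircase U)
  (hσ : U.image colOf = b.σ)

include hU hσ

theorem val_eq_card_filter_lt {s : Fin n ×ₗ Fin m} (hs : s ∈ U) {p : Fin (n + i)}
    (h : b.vertex p = colOf s) : (p : ℕ) = (U.filter (· < s)).card := by
  rw [← hU.card_filter_colOf_lt hs, hσ, ← h]
  exact (card_filter_lt_orderEmbOfFin b.σ b.card_eq p).symm

theorem cell_eq_of_card_filter_rowOf (hα : ∀ a, (U.filter (rowOf · = a)).card = b.α a + 1) :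
    b.cell = U := by
  have hrows (A : Finset (Fin n)) : ∑ a ∈ A, (b.α a + 1) = (U.filter (rowOf · ∈ A)).card := by
    rw [← Finset.sum_card_fiberwise_eq_card_filter]
    exact Finset.sum_congr rfl fun a _ => (hα a).symm
  refine (Finset.eq_of_subset_of_card_le (fun s hs => ?_) ?_).symm
  · obtain ⟨p, hp⟩ : colOf s ∈ Set.range b.vertex :=
      (Finset.range_orderEmbOfFin b.σ b.card_eq).symm ▸ hσ ▸ Finset.mem_image_of_mem _ hs
    refine mem_cell.mpr ⟨p, hp, ?_, Nat.lt_succ_iff.mp ?_⟩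
    · rw [blockStart_eq_sum, hrows, val_eq_card_filter_lt hU hσ hs hp]
      refine Finset.card_le_card (Finset.monotone_filter_right U fun t _ ht => ?_)
      exact lt_iff_rowOf_colOf.mpr (Or.inl (Finset.mem_Iio.mp ht))
    · rw [Nat.succ_eq_add_one, blockEnd_add_one_eq_sum, hrows, val_eq_card_filter_lt hU hσ hs hp]
      refine Finset.card_lt_card (Finset.ssubset_iff_of_subset ?_ |>.mpr ⟨s, by simpa, by simp⟩)
      refine Finset.monotone_filter_right U fun t _ ht => Finset.mem_Iic.mpr ?_
      rcases lt_iff_rowOf_colOf.mp ht with h | h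
      exacts [h.le, h.1.le]
  · rw [b.card_cell, ← b.card_eq, ← hσ, hU.card_image_colOf]

end

theorem exists_cell_eq {U : Finset (Fin n ×ₗ Fin m)} (hU : IsCell Γ U) (hc : U.card = n + i) :
    ∃ b : SparseIndex Γ n i, b.cell = U := by
  have hrow (a : Fin n) :
      (U.filter (rowOf · = a)).card = ((U.filter (rowOf · = a)).card - 1) + 1 := by
    obtain ⟨s, hs, hr⟩ := hU.meetsEveryRow a
    exact (Nat.succ_pred_eq_of_pos (Finset.card_pos.mpr ⟨s, by simp [hs, hr]⟩)).symm
  refine ⟨⟨fun a => (U.filter (rowOf · = a)).card - 1, U.image colOf, hU.mem, ?_, ?_⟩,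
    cell_eq_of_card_filter_rowOf hU.isStaircase rfl hrow⟩
  · rw [hU.isStaircase.card_image_colOf, hc]
  · have hsum := Finset.card_eq_sum_card_fiberwise (f := rowOf) (s := U) (t := Finset.univ)
      (by simp)
    rw [hc, Finset.sum_congr rfl fun a _ => hrow a, Finset.sum_add_distrib] at hsum
    simp only [Finset.sum_const, Finset.card_univ, Fintype.card_fin, smul_eq_mul,
      mul_one] at hsum
    omega

theorem cell_face (b : SparseIndex Γ n (i + 1)) {a : Fin n} {p : Fin (n + (i + 1))}
    (ha : 0 < b.α a) (hs : toLex (a, b.vertex p) ∈ b.cell) :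
    (b.face a ha p).cell = b.cell.erase (toLex (a, b.vertex p)) := by
  refine cell_eq_of_card_filter_rowOf (b.isStaircase_cell.mono (Finset.erase_subset _ _)) ?_ ?_
  · rw [b.isStaircase_cell.image_colOf_erase hs, b.image_colOf_cell]
    rfl
  · intro a'
    change _ = (b.α - Pi.single a 1 : Fin n → ℕ) a' + 1
    rw [Finset.filter_erase]
    obtain rfl | haa := eq_or_ne a' a
    · have hs' : toLex (a', b.vertex p) ∈ b.cell.filter (rowOf · = a') :=
        Finset.mem_filter.mpr ⟨hs, rfl⟩
      rw [Finset.card_erase_of_mem hs', b.card_filter_rowOf_cell, Pi.sub_apply,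
        Pi.single_eq_same]
      omega
    · rw [Finset.erase_eq_of_notMem fun h => haa (Finset.mem_filter.mp h).2.symm,
        b.card_filter_rowOf_cell, Pi.sub_apply, Pi.single_eq_of_ne haa, Nat.sub_zero]

end SparseIndex

/-! ### The Koszul differential -/

section Koszul

variable {V : Type*} [LinearOrder V] (A : Type*) [CommRing A]

/-- The sign `(-1)^p`, where `p` is the position, counted from `0`, that `s` has or would have
among the elements of `U`. -/
def positionSign (U : Finset V) (s : V) : A :=
  (-1) ^ (U.filter (· < s)).card

theorem positionSign_erase_self (U : Finset V) (s : V) :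
    positionSign A (U.erase s) s = positionSign A U s := by
  rw [positionSign, Finset.filter_erase, Finset.erase_eq_of_notMem (by simp), positionSign]

theorem positionSign_mul_self (U : Finset V) (s : V) :
    positionSign A U s * positionSign A U s = 1 := by
  rw [positionSign, ← mul_pow, neg_one_mul, neg_neg, one_pow]

theorem positionSign_insert_of_lt {U : Finset V} {s t : V} (hs : s ∉ U) (h : s < t) :
    positionSign A (insert s U) t = -positionSign A U t := by
  rw [positionSign, positionSign, Finset.filter_insert, if_pos h, Finset.card_insert_of_notMem
    (fun h => hs (Finset.mem_filter.mp h).1), pow_succ, mul_neg_one]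

theorem positionSign_insert_of_gt {U : Finset V} {s t : V} (h : t < s) :
    positionSign A (insert s U) t = positionSign A U t := by
  rw [positionSign, positionSign, Finset.filter_insert, if_neg h.not_gt]

theorem positionSign_mul_positionSign_insert {U : Finset V} {s t : V} (hs : s ∉ U) (ht : t ∉ U)
    (hne : s ≠ t) : positionSign A U s * positionSign A (insert s U) t =
      -(positionSign A U t * positionSign A (insert t U) s) := by
  rcases lt_or_gt_of_ne hne with h | h
  · rw [positionSign_insert_of_lt A hs h, positionSign_insert_of_gt A h]
    ring
  · rw [positionSign_insert_of_lt A ht h, positionSign_insert_of_gt A h]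
    ring

variable {A} [Fintype V]

/-- The differential `e_W ↦ ∑_{s ∈ W} ± x_s e_{W ∖ s}` of the Koszul complex of the family `x`, in
coordinates: `f U` is the coefficient of `e_U`. -/
def koszulDifferential (x : V → A) : (Finset V → A) →ₗ[A] (Finset V → A) :=
  LinearMap.pi fun U => ∑ s ∈ Uᶜ, (positionSign A U s * x s) • LinearMap.proj (insert s U)

theorem koszulDifferential_apply (x : V → A) (f : Finset V → A) (U : Finset V) :
    koszulDifferential x f U = ∑ s ∈ Uᶜ, positionSign A U s * x s * f (insert s U) := by
  simp [koszulDifferential]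

theorem koszulDifferential_single (x : V → A) (W : Finset V) (r : A) (U : Finset V) :
    koszulDifferential x (Pi.single W r) U =
      ∑ s ∈ W, if W.erase s = U then positionSign A W s * x s * r else 0 := by
  have hfilter : Uᶜ.filter (insert · U = W) = W.filter (W.erase · = U) := by
    ext s
    simp only [Finset.mem_filter, Finset.mem_compl]
    constructor
    · rintro ⟨hs, rfl⟩
      exact ⟨Finset.mem_insert_self s U, Finset.erase_insert hs⟩
    · rintro ⟨hs, rfl⟩
      exact ⟨Finset.notMem_erase s W, Finset.insert_erase hs⟩
  simp only [koszulDifferential_apply, Pi.single_apply, mul_ite, mul_zero]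
  rw [← Finset.sum_filter, ← Finset.sum_filter, hfilter]
  refine Finset.sum_congr rfl fun s hs => ?_
  rw [← (Finset.mem_filter.mp hs).2, positionSign_erase_self]

theorem koszulDifferential_koszulDifferential (x : V → A) (f : Finset V → A) :
    koszulDifferential x (koszulDifferential x f) = 0 := by
  ext1 U
  simp only [koszulDifferential_apply, Finset.mul_sum, Finset.sum_sigma', Pi.zero_apply]
  refine Finset.sum_involution (fun q _ => ⟨q.2, q.1⟩) ?_ ?_ ?_ (fun _ _ => rfl)
  all_goals
    rintro ⟨s, t⟩ hq
    simp only [Finset.mem_sigma, Finset.mem_compl, Finset.mem_insert, not_or] at hq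
  · dsimp only
    rw [Finset.insert_comm t s]
    linear_combination x s * x t * f (insert s (insert t U)) *
      positionSign_mul_positionSign_insert A hq.1 hq.2.2 (Ne.symm hq.2.1)
  · exact fun _ h => hq.2.1 (congrArg Sigma.fst h)
  · simp only [Finset.mem_sigma, Finset.mem_compl, Finset.mem_insert, not_or]
    exact ⟨hq.2.2, Ne.symm hq.2.1, hq.1⟩

end Koszul

/-! ### The differential in terms of cells -/

section Differential

variable {n m : ℕ} {Γ : PreAbstractSimplicialComplex (Fin m)} {i : ℕ}

/-- The coefficient of `y` at the basis element encoded by the cell `U`; it is `0` if `U` is not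
a cell with `n + i` points. -/
noncomputable def cellEntry {A : Type*} [AddCommMonoid A] (y : SparseIndex Γ n i →₀ A) :
    Finset (Fin n ×ₗ Fin m) → A :=
  y.mapDomain SparseIndex.cell

theorem cellEntry_cell {A : Type*} [AddCommMonoid A] (y : SparseIndex Γ n i →₀ A)
    (b : SparseIndex Γ n i) : cellEntry y b.cell = y b :=
  Finsupp.mapDomain_apply SparseIndex.cell_injective _ _

theorem cellEntry_eq_zero {A : Type*} [AddCommMonoid A] (y : SparseIndex Γ n i →₀ A)
    {U : Finset (Fin n ×ₗ Fin m)} (hU : ¬ (IsCell Γ U ∧ U.card = n + i)) :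
    cellEntry y U = 0 := by
  refine Finsupp.mapDomain_of_notMem_range _ _ ?_
  rintro ⟨b, rfl⟩
  exact hU ⟨b.isCell_cell, b.card_cell⟩

theorem cellEntry_add {A : Type*} [AddCommMonoid A] (y z : SparseIndex Γ n i →₀ A) :
    cellEntry (y + z) = cellEntry y + cellEntry z := by
  simp only [cellEntry, Finsupp.mapDomain_add, Finsupp.coe_add]

theorem cellEntry_single {A : Type*} [AddCommMonoid A] (b : SparseIndex Γ n i) (r : A) :
    cellEntry (Finsupp.single b r) = Pi.single b.cell r := by
  rw [cellEntry, Finsupp.mapDomain_single, Finsupp.single_eq_pi_single]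

theorem SparseIndex.image_sparsePairs (c : SparseIndex Γ n i) :
    (sparsePairs c.α (n + i)).image (fun q => toLex (q.1, c.vertex q.2)) =
      c.cell.filter fun s => 0 < c.α (rowOf s) := by
  ext s
  simp only [Finset.mem_image, mem_sparsePairs, Finset.mem_filter, SparseIndex.mem_cell]
  constructor
  · rintro ⟨q, ⟨hα, hq⟩, rfl⟩
    exact ⟨⟨q.2, rfl, hq⟩, hα⟩
  · rintro ⟨⟨p, hp, hp'⟩, hα⟩
    exact ⟨(rowOf s, p), ⟨hα, hp'⟩, eq_of_rowOf_eq_of_colOf_eq rfl hp⟩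

variable {k : Type*} [Field k]

theorem sparseDifferential_single_apply (c : SparseIndex Γ n (i + 1)) (r : GenericRing k n m)
    (b : SparseIndex Γ n i) :
    sparseDifferential k n Γ i (Finsupp.single c r) b = ∑ s ∈ c.cell,
      if c.cell.erase s = b.cell then positionSign (GenericRing k n m) c.cell s * X s * r
      else 0 := by
  classical
  let term (s : Fin n ×ₗ Fin m) : GenericRing k n m :=
    if c.cell.erase s = b.cell then positionSign _ c.cell s * X s * r else 0
  have hterm (q) (hq : q ∈ sparsePairs c.α (n + (i + 1))) :
      r * Finsupp.single (c.face q.1 (Finset.mem_filter.mp hq).2.1 q.2)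
        ((-1) ^ (q.2 : ℕ) * X (toLex (q.1, c.vertex q.2))) b =
          term (toLex (q.1, c.vertex q.2)) := by
    have hs : toLex (q.1, c.vertex q.2) ∈ c.cell := (Finset.mem_filter.mp
      (c.image_sparsePairs ▸ Finset.mem_image_of_mem _ hq)).1
    simp only [term, Finsupp.single_apply, ← SparseIndex.cell_injective.eq_iff, c.cell_face _ hs]
    rw [SparseIndex.val_eq_card_filter_lt c.isStaircase_cell c.image_colOf_cell hs rfl,
      mul_ite, mul_zero, mul_comm r]
    rfl
  have hinj : Function.Injective fun q : Fin n × Fin (n + (i + 1)) =>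
      (toLex (q.1, c.vertex q.2) : Fin n ×ₗ Fin m) := by
    intro q q' h
    exact Prod.ext (congrArg rowOf h :) (c.vertex_strictMono.injective (congrArg colOf h :))
  rw [sparseDifferential, Finsupp.linearCombination_single, Finsupp.smul_apply,
    Finsupp.finsetSum_apply, smul_eq_mul, Finset.mul_sum,
    Finset.sum_congr rfl fun q _ => hterm q.1 q.2,
    Finset.sum_attach (sparsePairs c.α (n + (i + 1))) fun q => term (toLex (q.1, c.vertex q.2)),
    ← Finset.sum_image (f := term) hinj.injOn, c.image_sparsePairs]
  refine Finset.sum_filter_of_ne fun s hsc hs => ?_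
  obtain ⟨t, ht, hts⟩ := b.meetsEveryRow_cell (rowOf s)
  rw [← (ite_ne_right_iff.mp hs).1, Finset.mem_erase] at ht
  have hrow : 1 < (c.cell.filter (rowOf · = rowOf s)).card := Finset.one_lt_card.mpr
    ⟨t, Finset.mem_filter.mpr ⟨ht.2, hts⟩, s, Finset.mem_filter.mpr ⟨hsc, rfl⟩, ht.1⟩
  rwa [c.card_filter_rowOf_cell, Nat.lt_add_left_iff_pos] at hrow

theorem sparseDifferential_apply (y : SparseIndex Γ n (i + 1) →₀ GenericRing k n m)
    (b : SparseIndex Γ n i) :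
    sparseDifferential k n Γ i y b = koszulDifferential X (cellEntry y) b.cell := by
  induction y using Finsupp.induction_linear with
  | zero => simp [cellEntry]
  | add y z hy hz =>
    rw [map_add, Finsupp.add_apply, hy, hz, cellEntry_add, map_add, Pi.add_apply]
  | single c r =>
    rw [sparseDifferential_single_apply, cellEntry_single, koszulDifferential_single]

theorem cellEntry_sparseDifferential (y : SparseIndex Γ n (i + 1) →₀ GenericRing k n m)
    {U : Finset (Fin n ×ₗ Fin m)} (hU : MeetsEveryRow U) :
    cellEntry (sparseDifferential k n Γ i y) U = koszulDifferential X (cellEntry y) U := by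
  by_cases hcell : IsCell Γ U ∧ U.card = n + i
  · obtain ⟨b, rfl⟩ := SparseIndex.exists_cell_eq hcell.1 hcell.2
    rw [cellEntry_cell, sparseDifferential_apply]
  · rw [cellEntry_eq_zero _ hcell, koszulDifferential_apply, Finset.sum_eq_zero fun s hs => ?_]
    rw [cellEntry_eq_zero, mul_zero]
    rintro ⟨hins, hcard⟩
    rw [Finset.card_insert_of_notMem (Finset.mem_compl.mp hs)] at hcard
    exact hcell ⟨hins.of_subset (Finset.subset_insert _ _) hU, by omega⟩

theorem sparseDifferential_sparseDifferential
    (y : SparseIndex Γ n (i + 1 + 1) →₀ GenericRing k n m) :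
    sparseDifferential k n Γ i (sparseDifferential k n Γ (i + 1) y) = 0 := by
  ext1 b
  have hentry : koszulDifferential X (cellEntry (sparseDifferential k n Γ (i + 1) y)) b.cell =
      koszulDifferential X (koszulDifferential X (cellEntry y)) b.cell := by
    simp only [koszulDifferential_apply X _ b.cell]
    refine Finset.sum_congr rfl fun s _ => ?_
    rw [cellEntry_sparseDifferential y
      (b.meetsEveryRow_cell.mono (Finset.subset_insert _ _))]
  rw [sparseDifferential_apply, hentry, koszulDifferential_koszulDifferential]
  rfl

end Differential

/-! ### Removing points from staircases -/

section Adjacency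

variable {V : Type*} [LinearOrder V]

/-- `s < t` are consecutive elements of `W`. -/
structure AdjacentIn (W : Finset V) (s t : V) : Prop where
  left_mem : s ∈ W
  right_mem : t ∈ W
  lt : s < t
  not_between : ∀ x ∈ W, ¬ (s < x ∧ x < t)

variable {W : Finset V} {s t : V}

theorem AdjacentIn.mono {W' : Finset V} (h : AdjacentIn W s t) (hW' : W' ⊆ W) (hs : s ∈ W')
    (ht : t ∈ W') : AdjacentIn W' s t :=
  ⟨hs, ht, h.lt, fun x hx => h.not_between x (hW' hx)⟩

theorem AdjacentIn.exists_orderEmbOfFin_eq (h : AdjacentIn W s t) :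
    ∃ (j : ℕ) (hj : j + 1 < W.card),
      W.orderEmbOfFin rfl ⟨j, by omega⟩ = s ∧ W.orderEmbOfFin rfl ⟨j + 1, hj⟩ = t := by
  have hrange {x} (hx : x ∈ W) : x ∈ Set.range (W.orderEmbOfFin rfl) := by
    rwa [Finset.range_orderEmbOfFin, Finset.mem_coe]
  obtain ⟨p, rfl⟩ := hrange h.left_mem
  obtain ⟨q, rfl⟩ := hrange h.right_mem
  have hpq : p < q := (OrderEmbedding.lt_iff_lt _).mp h.lt
  have hp : (p : ℕ) + 1 < W.card := (Nat.succ_le_of_lt hpq).trans_lt q.2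
  refine ⟨p, hp, rfl, ((W.orderEmbOfFin rfl).monotone (Nat.succ_le_of_lt hpq)).antisymm ?_⟩
  exact le_of_not_gt fun hlt => h.not_between _ (Finset.orderEmbOfFin_mem _ _ _)
    ⟨(OrderEmbedding.lt_iff_lt _).mpr (Nat.lt_succ_self p), hlt⟩

theorem AdjacentIn.positionSign_eq_neg (A : Type*) [CommRing A] (h : AdjacentIn W s t) :
    positionSign A W t = -positionSign A W s := by
  have hfilter : W.filter (· < t) = insert s (W.filter (· < s)) := by
    ext x
    simp only [Finset.mem_filter, Finset.mem_insert]
    constructor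
    · rintro ⟨hx, hxt⟩
      rcases lt_trichotomy x s with hxs | hxs | hxs
      exacts [Or.inr ⟨hx, hxs⟩, Or.inl hxs, absurd ⟨hxs, hxt⟩ (h.not_between x hx)]
    · rintro (rfl | ⟨hx, hxs⟩)
      exacts [⟨h.left_mem, h.lt⟩, ⟨hx, hxs.trans h.lt⟩]
  rw [positionSign, positionSign, hfilter, Finset.card_insert_of_notMem (by simp), pow_succ,
    mul_neg_one]

theorem AdjacentIn.of_erase {r : V} (hr : r ∈ W) (h : AdjacentIn (W.erase r) s t) :
    AdjacentIn W s t ∨ AdjacentIn W s r := by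
  have hs := Finset.mem_of_mem_erase h.left_mem
  have hbetween {x : V} (hx : x ∈ W) (hxr : x ≠ r) : ¬ (s < x ∧ x < t) :=
    h.not_between x (Finset.mem_erase.mpr ⟨hxr, hx⟩)
  by_cases hsrt : s < r ∧ r < t
  · exact Or.inr ⟨hs, hr, hsrt.1, fun x hx hlt => hbetween hx hlt.2.ne
      ⟨hlt.1, hlt.2.trans hsrt.2⟩⟩
  · refine Or.inl ⟨hs, Finset.mem_of_mem_erase h.right_mem, h.lt, fun x hx hlt => ?_⟩
    obtain rfl | hxr := eq_or_ne x r
    exacts [hsrt hlt, hbetween hx hxr hlt]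

end Adjacency

section Removal

variable {n m : ℕ} {W : Finset (Fin n ×ₗ Fin m)} {s t : Fin n ×ₗ Fin m}

theorem rowOf_mono (h : s ≤ t) : rowOf s ≤ rowOf t :=
  Prod.Lex.monotone_fst s t h

theorem exists_adjacentIn_rowOf_eq (h : n < W.card) :
    ∃ s t, AdjacentIn W s t ∧ rowOf s = rowOf t := by
  obtain ⟨s, hs, t, ht, hst, hr⟩ : ∃ s ∈ W, ∃ t ∈ W, s < t ∧ rowOf s = rowOf t := by
    obtain ⟨s, hs, t, ht, hne, hr⟩ := Finset.exists_ne_map_eq_of_card_lt_of_maps_to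
      (s := W) (t := Finset.univ) (f := rowOf) (by simpa using h) (by simp)
    rcases hne.lt_or_gt with hlt | hlt
    exacts [⟨s, hs, t, ht, hlt, hr⟩, ⟨t, ht, s, hs, hlt, hr.symm⟩]
  obtain ⟨u, hu, hmin⟩ := (W.filter (s < ·)).exists_minimal
    ⟨t, Finset.mem_filter.mpr ⟨ht, hst⟩⟩
  rw [Finset.mem_filter] at hu
  have hut : u ≤ t := le_of_not_gt fun h =>
    h.not_ge (hmin (Finset.mem_filter.mpr ⟨ht, hst⟩) h.le)
  refine ⟨s, u, ⟨hs, hu.1, hu.2, fun x hx hlt => ?_⟩,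
    (rowOf_mono hu.2.le).antisymm ((rowOf_mono hut).trans hr.ge)⟩
  exact hlt.2.not_ge (hmin (Finset.mem_filter.mpr ⟨hx, hlt.1⟩) hlt.2.le)

theorem MeetsEveryRow.injOn_rowOf (hW : MeetsEveryRow W) (hc : W.card = n) :
    Set.InjOn rowOf (W : Set (Fin n ×ₗ Fin m)) := by
  refine Finset.injOn_of_card_image_eq ?_
  have himage : W.image rowOf = Finset.univ :=
    Finset.eq_univ_iff_forall.mpr fun a => Finset.mem_image.mpr (hW a)
  rw [himage, hc, Finset.card_univ, Fintype.card_fin]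

theorem exists_adjacentIn_meetsEveryRow_erase_iff (hW : MeetsEveryRow W) (hc : W.card = n + 1) :
    ∃ s t, AdjacentIn W s t ∧ rowOf s = rowOf t ∧
      ∀ r ∈ W, MeetsEveryRow (W.erase r) ↔ r = s ∨ r = t := by
  obtain ⟨s, t, hst, hr⟩ := exists_adjacentIn_rowOf_eq (W := W) (by omega)
  have hs := hW.erase hst.right_mem hst.lt.ne' hr.symm
  have ht := hW.erase hst.left_mem hst.lt.ne hr
  refine ⟨s, t, hst, hr, fun r hrW => ⟨fun hrow => ?_, ?_⟩⟩
  · have hinj := hs.injOn_rowOf (by rw [Finset.card_erase_of_mem hst.left_mem, hc]; rfl)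
    have htmem : t ∈ W.erase s := Finset.mem_erase.mpr ⟨hst.lt.ne', hst.right_mem⟩
    by_contra! hne
    have hrmem : r ∈ W.erase s := Finset.mem_erase.mpr ⟨hne.1, hrW⟩
    obtain ⟨x, hx, hxr⟩ := hrow (rowOf r)
    obtain ⟨hxne, hxW⟩ := Finset.mem_erase.mp hx
    obtain rfl | hxs := eq_or_ne x s
    · exact hne.2 (hinj hrmem htmem (hxr.symm.trans hr))
    · exact hxne (hinj (Finset.mem_erase.mpr ⟨hxs, hxW⟩) hrmem hxr)
  · rintro (rfl | rfl)
    exacts [hs, ht]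

theorem isStaircase_of_erase₂ (hs : IsStaircase (W.erase s)) (ht : IsStaircase (W.erase t))
    (hne : s ≠ t) (hr : rowOf s = rowOf t) : IsStaircase W := by
  intro x hx z hz hxz
  by_cases h : x = s ∨ z = s
  · refine ht (Finset.mem_erase.mpr ⟨?_, hx⟩) (Finset.mem_erase.mpr ⟨?_, hz⟩) hxz <;> grind
  · refine hs (Finset.mem_erase.mpr ⟨?_, hx⟩) (Finset.mem_erase.mpr ⟨?_, hz⟩) hxz <;> grind

theorem isStaircase_of_erase₃ {u : Fin n ×ₗ Fin m} (hs : IsStaircase (W.erase s))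
    (ht : IsStaircase (W.erase t)) (hu : IsStaircase (W.erase u)) (hst : s ≠ t) (hsu : s ≠ u)
    (htu : t ≠ u) : IsStaircase W := by
  intro x hx z hz hxz
  obtain ⟨r, hr, hrx, hrz⟩ : ∃ r, IsStaircase (W.erase r) ∧ x ≠ r ∧ z ≠ r := by grind
  exact hr (Finset.mem_erase.mpr ⟨hrx, hx⟩) (Finset.mem_erase.mpr ⟨hrz, hz⟩) hxz

/-- The absence of `1`-nonfaces with more than `n` elements. -/
def HasAdjacentProperty (n : ℕ) (Γ : PreAbstractSimplicialComplex (Fin m)) : Prop :=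
  ∀ σ : Finset (Fin m), n < σ.card → ∀ u v, AdjacentIn σ u v →
    σ.erase u ∈ Γ → σ.erase v ∈ Γ → σ ∈ Γ

variable {Γ : PreAbstractSimplicialComplex (Fin m)}

theorem IsStaircase.isCell_of_adjacentIn (hΓ : HasAdjacentProperty n Γ) (hW : IsStaircase W)
    (hc : n < W.card) (hst : AdjacentIn W s t) (hs : IsCell Γ (W.erase s))
    (ht : IsCell Γ (W.erase t)) : IsCell Γ W where
  isStaircase := hW
  meetsEveryRow := hs.meetsEveryRow.mono (Finset.erase_subset s W)
  mem := by
    have hlt {x z : Fin n ×ₗ Fin m} (hx : x ∈ W) (hz : z ∈ W) : colOf x < colOf z ↔ x < z :=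
      hW.strictMonoOn_colOf.lt_iff_lt hx hz
    refine hΓ _ (by rwa [hW.card_image_colOf]) (colOf s) (colOf t)
      ⟨Finset.mem_image_of_mem _ hst.left_mem, Finset.mem_image_of_mem _ hst.right_mem,
        (hlt hst.left_mem hst.right_mem).mpr hst.lt, ?_⟩
      (hW.image_colOf_erase hst.left_mem ▸ hs.mem) (hW.image_colOf_erase hst.right_mem ▸ ht.mem)
    intro j hj
    obtain ⟨x, hx, rfl⟩ := Finset.mem_image.mp hj
    rw [hlt hst.left_mem hx, hlt hx hst.right_mem]
    exact hst.not_between x hx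

theorem isCell_of_isCell_erase₂ (hΓ : HasAdjacentProperty n Γ) (hc : W.card = n + 1)
    (hs : IsCell Γ (W.erase s)) (ht : IsCell Γ (W.erase t)) (hsW : s ∈ W) (htW : t ∈ W)
    (hne : s ≠ t) : IsCell Γ W := by
  obtain ⟨u, v, huv, hr, hiff⟩ := exists_adjacentIn_meetsEveryRow_erase_iff
    (hs.meetsEveryRow.mono (Finset.erase_subset s W)) hc
  obtain ⟨hu, hv⟩ : IsCell Γ (W.erase u) ∧ IsCell Γ (W.erase v) := by
    rcases (hiff s hsW).mp hs.meetsEveryRow with rfl | rfl <;>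
      rcases (hiff t htW).mp ht.meetsEveryRow with rfl | rfl
    exacts [absurd rfl hne, ⟨hs, ht⟩, ⟨ht, hs⟩, absurd rfl hne]
  exact (isStaircase_of_erase₂ hu.isStaircase hv.isStaircase huv.lt.ne hr).isCell_of_adjacentIn hΓ
    (by omega) huv hu hv

theorem isCell_of_isCell_erase₃ (hΓ : HasAdjacentProperty n Γ) (hc : n < W.card)
    {r : Fin n ×ₗ Fin m} (hrW : r ∈ W) (hst : AdjacentIn (W.erase r) s t)
    (hr : IsCell Γ (W.erase r)) (hs : IsCell Γ (W.erase s)) (ht : IsCell Γ (W.erase t)) :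
    IsCell Γ W := by
  have hW : IsStaircase W := isStaircase_of_erase₃ hr.isStaircase hs.isStaircase ht.isStaircase
    (Finset.ne_of_mem_erase hst.left_mem).symm (Finset.ne_of_mem_erase hst.right_mem).symm
    hst.lt.ne
  rcases hst.of_erase hrW with h | h
  exacts [hW.isCell_of_adjacentIn hΓ hc h hs ht, hW.isCell_of_adjacentIn hΓ hc h hs hr]

end Removal

/-! ### The augmentation in terms of cells -/

section Augmentation

variable {n m : ℕ}

/-- The exponent of the product of the variables in `U`. -/
noncomputable def cellExponent (U : Finset (Fin n ×ₗ Fin m)) : (Fin n ×ₗ Fin m) →₀ ℕ :=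
  ∑ s ∈ U, Finsupp.single s 1

theorem cellExponent_apply (U : Finset (Fin n ×ₗ Fin m)) (t : Fin n ×ₗ Fin m) :
    cellExponent U t = if t ∈ U then 1 else 0 := by
  simp [cellExponent, Finsupp.single_apply]

theorem single_add_cellExponent_erase {W : Finset (Fin n ×ₗ Fin m)} {s : Fin n ×ₗ Fin m}
    (hs : s ∈ W) : Finsupp.single s 1 + cellExponent (W.erase s) = cellExponent W :=
  Finset.add_sum_erase W _ hs

theorem subset_of_cellExponent_le {U W : Finset (Fin n ×ₗ Fin m)}
    (h : cellExponent U ≤ cellExponent W) : U ⊆ W := by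
  intro s hs
  by_contra hsW
  have := h s
  simp [cellExponent_apply, hs, hsW] at this

theorem subset_insert_of_cellExponent_le {U W : Finset (Fin n ×ₗ Fin m)} {t : Fin n ×ₗ Fin m}
    (h : cellExponent U ≤ Finsupp.single t 1 + cellExponent W) : U ⊆ insert t W := by
  intro s hs
  by_contra hsW
  obtain ⟨hst, hsW⟩ := not_or.mp fun h => hsW (Finset.mem_insert.mpr h)
  have := h s
  simp [cellExponent_apply, hs, hsW, Finsupp.single_eq_of_ne hst] at this

variable {Γ : PreAbstractSimplicialComplex (Fin m)}

theorem diagExponent_eq_cellExponent (b : SparseIndex Γ n 0) :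
    diagExponent b.σ b.card_eq = cellExponent b.cell := by
  have hα (a : Fin n) : b.α a = 0 := Finset.sum_eq_zero_iff.mp b.sum_eq a (Finset.mem_univ a)
  ext s
  obtain ⟨⟨r, j⟩, rfl⟩ := toLex.surjective s
  rw [diagExponent, permExponent_apply, cellExponent_apply]
  refine if_congr ?_ rfl rfl
  simp only [SparseIndex.mem_cell, blockStart, blockEnd, hα, Finset.sum_const_zero, add_zero]
  constructor
  · exact fun h => ⟨r, h, le_rfl, le_rfl⟩
  · rintro ⟨p, hp, hrp, hpr⟩
    rwa [show p = r from Fin.ext (le_antisymm hpr hrp)] at hp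

variable {k : Type*} [Field k]

theorem sparseAugmentation_single (b : SparseIndex Γ n 0) (r : GenericRing k n m) :
    sparseAugmentation k n Γ (Finsupp.single b r) = monomial (cellExponent b.cell) 1 * r := by
  rw [sparseAugmentation, Finsupp.linearCombination_single, lex_leadingTerm_maximalMinor,
    diagExponent_eq_cellExponent, smul_eq_mul, mul_comm]

theorem sparseAugmentation_apply (y : SparseIndex Γ n 0 →₀ GenericRing k n m) :
    sparseAugmentation k n Γ y = ∑ U, monomial (cellExponent U) 1 * cellEntry y U := by
  induction y using Finsupp.induction_linear with
  | zero => simp [cellEntry]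
  | add y z hy hz =>
    simp only [map_add, hy, hz, cellEntry_add, Pi.add_apply, mul_add, Finset.sum_add_distrib]
  | single b r =>
    simp only [sparseAugmentation_single, cellEntry_single, Pi.single_apply, mul_ite, mul_zero,
      Finset.sum_ite_eq', Finset.mem_univ, if_true]

open Classical in
theorem coeff_sparseAugmentation (u : (Fin n ×ₗ Fin m) →₀ ℕ)
    (y : SparseIndex Γ n 0 →₀ GenericRing k n m) :
    coeff u (sparseAugmentation k n Γ y) =
      ∑ U, if cellExponent U ≤ u then coeff (u - cellExponent U) (cellEntry y U) else 0 := by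
  simp only [sparseAugmentation_apply, coeff_sum, coeff_monomial_mul', one_mul]

open Classical in
theorem sparseAugmentation_sparseDifferential_single (c : SparseIndex Γ n 1)
    (r : GenericRing k n m) :
    sparseAugmentation k n Γ (sparseDifferential k n Γ 0 (Finsupp.single c r)) =
      ∑ s ∈ c.cell, if MeetsEveryRow (c.cell.erase s) then
        positionSign (GenericRing k n m) c.cell s * monomial (cellExponent c.cell) 1 * r
      else 0 := by
  have hterm (U : Finset (Fin n ×ₗ Fin m)) : monomial (cellExponent U) 1 *
      cellEntry (sparseDifferential k n Γ 0 (Finsupp.single c r)) U =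
        ∑ s ∈ c.cell, if c.cell.erase s = U then if MeetsEveryRow U then
          positionSign (GenericRing k n m) c.cell s * monomial (cellExponent c.cell) 1 * r
        else 0 else 0 := by
    by_cases hU : MeetsEveryRow U
    · rw [cellEntry_sparseDifferential _ hU, cellEntry_single, koszulDifferential_single,
        Finset.mul_sum]
      refine Finset.sum_congr rfl fun s hs => ?_
      rw [if_pos hU, mul_ite, mul_zero]
      refine if_ctx_congr Iff.rfl (fun hsU => ?_) fun _ => rfl
      have hX : X s * monomial (cellExponent U) (1 : k) = monomial (cellExponent c.cell) 1 := by
        rw [X, monomial_mul, one_mul, ← hsU, single_add_cellExponent_erase hs]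
      rw [← hX]
      ring
    · simp [cellEntry_eq_zero _ fun h => hU h.1.meetsEveryRow, hU]
  simp only [sparseAugmentation_apply, hterm]
  rw [Finset.sum_comm]
  simp only [Finset.sum_ite_eq, Finset.mem_univ, if_true]

theorem sparseAugmentation_sparseDifferential (y : SparseIndex Γ n 1 →₀ GenericRing k n m) :
    sparseAugmentation k n Γ (sparseDifferential k n Γ 0 y) = 0 := by
  suffices h : sparseAugmentation k n Γ ∘ₗ sparseDifferential k n Γ 0 = 0 from
    LinearMap.congr_fun h y
  refine Finsupp.lhom_ext fun c r => ?_
  obtain ⟨s, t, hst, -, hiff⟩ :=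
    exists_adjacentIn_meetsEveryRow_erase_iff c.meetsEveryRow_cell c.card_cell
  rw [LinearMap.comp_apply, sparseAugmentation_sparseDifferential_single,
    Finset.sum_eq_add_of_mem s t hst.left_mem hst.right_mem hst.lt.ne fun x hx hne =>
      if_neg fun h => not_or.mpr hne ((hiff x hx).mp h),
    if_pos ((hiff s hst.left_mem).mpr (Or.inl rfl)),
    if_pos ((hiff t hst.right_mem).mpr (Or.inr rfl)),
    hst.positionSign_eq_neg _, neg_mul, neg_mul, add_neg_cancel, LinearMap.zero_apply]

end Augmentation

/-! ### Linear cycles -/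

section LinearForms

variable {R V : Type*} [CommSemiring R]

theorem eq_single_of_degree_eq_one {u : V →₀ ℕ} (h : u.degree = 1) :
    ∃ s, u = Finsupp.single s 1 := by
  obtain ⟨s, hs⟩ : ∃ s, u s ≠ 0 := by
    by_contra! hu
    simp [show u = 0 from Finsupp.ext hu] at h
  obtain ⟨v, rfl⟩ := le_iff_exists_add.mp
    (Finsupp.single_le_iff.mpr (Nat.one_le_iff_ne_zero.mpr hs))
  rw [map_add, Finsupp.degree_single, Nat.add_eq_left, Finsupp.degree_eq_zero_iff] at h
  exact ⟨s, by rw [h, add_zero]⟩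

theorem eq_of_coeff_single_eq {p q : MvPolynomial V R} (hp : p.IsHomogeneous 1)
    (hq : q.IsHomogeneous 1)
    (h : ∀ s, coeff (Finsupp.single s 1) p = coeff (Finsupp.single s 1) q) : p = q := by
  ext u
  by_cases hu : u.degree = 1
  · obtain ⟨s, rfl⟩ := eq_single_of_degree_eq_one hu
    exact h s
  · rw [hp.coeff_eq_zero hu, hq.coeff_eq_zero hu]

theorem coeff_single_add_single_X_mul [DecidableEq V] (s t r : V) (p : MvPolynomial V R) :
    coeff (Finsupp.single s 1 + Finsupp.single t 1) (X r * p) =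
      if r = s then coeff (Finsupp.single t 1) p
      else if r = t then coeff (Finsupp.single s 1) p else 0 := by
  split_ifs with hs ht
  · rw [hs, coeff_X_mul]
  · rw [ht, add_comm, coeff_X_mul]
  · rw [coeff_X_mul', if_neg]
    simp [Finsupp.single_eq_of_ne hs, Finsupp.single_eq_of_ne ht]

end LinearForms

section KoszulCoefficients

variable {R V : Type*} [CommRing R] [LinearOrder V]

theorem positionSign_mvPolynomial (U : Finset V) (s : V) :
    positionSign (MvPolynomial V R) U s = C (positionSign R U s) := by
  simp [positionSign]

variable [Fintype V] {U : Finset V} {s t : V}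

theorem coeff_koszulDifferential_X_C (f : Finset V → R) (U : Finset V) (s : V) :
    coeff (Finsupp.single s 1) (koszulDifferential X (fun W => C (f W)) U) =
      if s ∈ U then 0 else positionSign R U s * f (insert s U) := by
  have hcoeff (r : V) : coeff (Finsupp.single s 1) (X r * C (f (insert r U))) =
      if r = s then f (insert r U) else 0 := by
    rw [mul_comm, coeff_C_mul, coeff_X, mul_ite, mul_one, mul_zero]
    simp only [Finsupp.single_left_inj one_ne_zero]
  simp only [koszulDifferential_apply, coeff_sum, positionSign_mvPolynomial, mul_assoc,
    coeff_C_mul, hcoeff, mul_ite, mul_zero, Finset.sum_ite_eq', Finset.mem_compl, ite_not]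

theorem coeff_koszulDifferential_X (f : Finset V → MvPolynomial V R) (U : Finset V) (s t : V) :
    coeff (Finsupp.single s 1 + Finsupp.single t 1) (koszulDifferential X f U) =
      ∑ r ∈ Uᶜ, positionSign R U r * if r = s then coeff (Finsupp.single t 1) (f (insert r U))
        else if r = t then coeff (Finsupp.single s 1) (f (insert r U)) else 0 := by
  simp only [koszulDifferential_apply, coeff_sum, positionSign_mvPolynomial, mul_assoc,
    coeff_C_mul, coeff_single_add_single_X_mul]

theorem coeff_koszulDifferential_X_of_ne (f : Finset V → MvPolynomial V R) (hs : s ∉ U)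
    (ht : t ∉ U) (hne : s ≠ t) :
    coeff (Finsupp.single s 1 + Finsupp.single t 1) (koszulDifferential X f U) =
      positionSign R U s * coeff (Finsupp.single t 1) (f (insert s U)) +
        positionSign R U t * coeff (Finsupp.single s 1) (f (insert t U)) := by
  rw [coeff_koszulDifferential_X, Finset.sum_eq_add_of_mem s t (Finset.mem_compl.mpr hs)
    (Finset.mem_compl.mpr ht) hne fun r _ hr => by simp [hr.1, hr.2], if_pos rfl,
    if_neg hne.symm, if_pos rfl]

theorem coeff_koszulDifferential_X_of_mem_insert (f : Finset V → MvPolynomial V R) (hs : s ∉ U)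
    (ht : t ∈ insert s U) :
    coeff (Finsupp.single s 1 + Finsupp.single t 1) (koszulDifferential X f U) =
      positionSign R U s * coeff (Finsupp.single t 1) (f (insert s U)) := by
  rw [coeff_koszulDifferential_X, Finset.sum_eq_single_of_mem s (Finset.mem_compl.mpr hs),
    if_pos rfl]
  intro r hr hrs
  have hrt : r ≠ t := by
    rintro rfl
    exact (Finset.mem_insert.mp ht).elim hrs (Finset.mem_compl.mp hr)
  rw [if_neg hrs, if_neg hrt, mul_zero]

end KoszulCoefficients

theorem MeetsEveryRow.erase_erase_or {n m : ℕ} {W : Finset (Fin n ×ₗ Fin m)}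
    {s t : Fin n ×ₗ Fin m} (hs : MeetsEveryRow (W.erase s)) (ht : MeetsEveryRow (W.erase t))
    (hc : n < (W.erase s).card) :
    MeetsEveryRow ((W.erase s).erase t) ∨ ∃ r ∈ W, r ≠ s ∧ r ≠ t ∧
      MeetsEveryRow ((W.erase s).erase r) ∧ MeetsEveryRow ((W.erase t).erase r) := by
  obtain ⟨r, r', h, hr⟩ := exists_adjacentIn_rowOf_eq hc
  obtain rfl | hrt := eq_or_ne r t
  · exact Or.inl (hs.erase h.right_mem h.lt.ne' hr.symm)
  obtain rfl | hrt' := eq_or_ne r' t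
  · exact Or.inl (hs.erase h.left_mem h.lt.ne hr)
  obtain ⟨hrs, hrW⟩ := Finset.mem_erase.mp h.left_mem
  exact Or.inr ⟨r, hrW, hrs, hrt, hs.erase h.right_mem h.lt.ne' hr.symm,
    ht.erase (Finset.mem_erase.mpr ⟨hrt', Finset.mem_of_mem_erase h.right_mem⟩) h.lt.ne'
      hr.symm⟩

section LinearCycles

variable {k : Type*} [Field k] {n m : ℕ} {Γ : PreAbstractSimplicialComplex (Fin m)} {i : ℕ}

/-- The coefficient of `x_s` in the entry of `y` at the cell `U`. -/
noncomputable def cellCoeff (y : SparseIndex Γ n i →₀ GenericRing k n m)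
    (U : Finset (Fin n ×ₗ Fin m)) (s : Fin n ×ₗ Fin m) : k :=
  coeff (Finsupp.single s 1) (cellEntry y U)

/-- The coefficients of `y` sit where a boundary of a vector of constants can have them. -/
def IsSupportedOnBoundaries (y : SparseIndex Γ n i →₀ GenericRing k n m) : Prop :=
  ∀ U s, cellCoeff y U s ≠ 0 → s ∉ U ∧ IsCell Γ (insert s U)

/-- The coefficients of `y` determine, independently of the choice of a facet, the coefficients of
a vector of constants with boundary `y`. -/
def IsCompatibleOnCells (y : SparseIndex Γ n i →₀ GenericRing k n m) : Prop :=
  ∀ W, W.card = n + (i + 1) → ∀ s ∈ W, ∀ t ∈ W,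
    MeetsEveryRow (W.erase s) → MeetsEveryRow (W.erase t) →
      positionSign k W s * cellCoeff y (W.erase s) s =
        positionSign k W t * cellCoeff y (W.erase t) t

theorem isCell_of_cellCoeff_ne_zero {y : SparseIndex Γ n i →₀ GenericRing k n m}
    {U : Finset (Fin n ×ₗ Fin m)} {s : Fin n ×ₗ Fin m} (h : cellCoeff y U s ≠ 0) :
    IsCell Γ U ∧ U.card = n + i := by
  by_contra hU
  rw [cellCoeff, cellEntry_eq_zero y hU, coeff_zero] at h
  exact h rfl

theorem positionSign_ne_zero (U : Finset (Fin n ×ₗ Fin m)) (s : Fin n ×ₗ Fin m) :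
    positionSign k U s ≠ 0 :=
  left_ne_zero_of_mul (positionSign_mul_self k U s ▸ one_ne_zero)

section Differential

variable {y : SparseIndex Γ n (i + 1) →₀ GenericRing k n m}
  (hy : sparseDifferential k n Γ i y = 0) {U : Finset (Fin n ×ₗ Fin m)}
  {s t : Fin n ×ₗ Fin m}

include hy

theorem koszulDifferential_cellEntry_eq_zero (hU : MeetsEveryRow U) :
    koszulDifferential X (cellEntry y) U = 0 := by
  rw [← cellEntry_sparseDifferential y hU, hy, cellEntry, Finsupp.mapDomain_zero,
    Finsupp.zero_apply]

theorem positionSign_mul_cellCoeff_add (hU : MeetsEveryRow U) (hs : s ∉ U) (ht : t ∉ U)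
    (hne : s ≠ t) : positionSign k U s * cellCoeff y (insert s U) t +
      positionSign k U t * cellCoeff y (insert t U) s = 0 := by
  rw [cellCoeff, cellCoeff, ← coeff_koszulDifferential_X_of_ne _ hs ht hne,
    koszulDifferential_cellEntry_eq_zero hy hU, coeff_zero]

theorem cellCoeff_insert_eq_zero (hU : MeetsEveryRow U) (hs : s ∉ U) (ht : t ∈ insert s U) :
    cellCoeff y (insert s U) t = 0 := by
  refine (mul_eq_zero.mp ?_).resolve_left (positionSign_ne_zero (k := k) U s)
  rw [cellCoeff, ← coeff_koszulDifferential_X_of_mem_insert _ hs ht,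
    koszulDifferential_cellEntry_eq_zero hy hU, coeff_zero]

theorem isCell_insert_erase_of_cellCoeff_ne_zero (hUs : cellCoeff y U s ≠ 0) (ht : t ∈ U)
    (hrow : MeetsEveryRow (U.erase t)) : s ∉ U ∧ IsCell Γ (insert s (U.erase t)) := by
  have hsU : s ∉ U := by
    intro hs
    have h := cellCoeff_insert_eq_zero hy hrow (Finset.notMem_erase t U) (t := s)
    rw [Finset.insert_erase ht] at h
    exact hUs (h hs)
  refine ⟨hsU, (isCell_of_cellCoeff_ne_zero (y := y) (s := t) fun h0 => ?_).1⟩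
  have h := positionSign_mul_cellCoeff_add hy hrow (Finset.notMem_erase t U)
    (fun hs => hsU (Finset.mem_of_mem_erase hs)) fun hts => hsU (hts ▸ ht)
  rw [Finset.insert_erase ht, h0, mul_zero, add_zero] at h
  exact mul_ne_zero (positionSign_ne_zero _ _) hUs h

theorem isSupportedOnBoundaries_of_sparseDifferential_eq_zero (hΓ : HasAdjacentProperty n Γ) :
    IsSupportedOnBoundaries y := by
  intro U s hUs
  obtain ⟨hU, hc⟩ := isCell_of_cellCoeff_ne_zero hUs
  obtain ⟨t, t', htt, hr⟩ := exists_adjacentIn_rowOf_eq (W := U) (by omega)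
  obtain ⟨hsU, ht⟩ := isCell_insert_erase_of_cellCoeff_ne_zero hy hUs htt.left_mem
    (hU.meetsEveryRow.erase htt.right_mem htt.lt.ne' hr.symm)
  obtain ⟨-, ht'⟩ := isCell_insert_erase_of_cellCoeff_ne_zero hy hUs htt.right_mem
    (hU.meetsEveryRow.erase htt.left_mem htt.lt.ne hr)
  have herase : (insert s U).erase s = U := Finset.erase_insert hsU
  have hst : s ≠ t := fun h => hsU (h ▸ htt.left_mem)
  have hst' : s ≠ t' := fun h => hsU (h ▸ htt.right_mem)
  refine ⟨hsU, isCell_of_isCell_erase₃ hΓ ?_ (Finset.mem_insert_self s U)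
    (herase.symm ▸ htt) (herase.symm ▸ hU) ?_ ?_⟩
  · rw [Finset.card_insert_of_notMem hsU]
    omega
  · rwa [Finset.erase_insert_of_ne hst]
  · rwa [Finset.erase_insert_of_ne hst']

theorem positionSign_mul_cellCoeff_erase_eq {W : Finset (Fin n ×ₗ Fin m)} (hs : s ∈ W)
    (ht : t ∈ W) (hne : s ≠ t) (hrow : MeetsEveryRow ((W.erase s).erase t)) :
    positionSign k W s * cellCoeff y (W.erase s) s =
      positionSign k W t * cellCoeff y (W.erase t) t := by
  have hsU : s ∉ (W.erase s).erase t :=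
    fun h => Finset.notMem_erase s W (Finset.mem_of_mem_erase h)
  have htU : t ∉ (W.erase s).erase t := Finset.notMem_erase t _
  have hinsert_t : insert t ((W.erase s).erase t) = W.erase s :=
    Finset.insert_erase (Finset.mem_erase.mpr ⟨hne.symm, ht⟩)
  have hinsert_s : insert s ((W.erase s).erase t) = W.erase t := by
    rw [Finset.erase_right_comm, Finset.insert_erase (Finset.mem_erase.mpr ⟨hne, hs⟩)]
  have hcoeff := positionSign_mul_cellCoeff_add hy hrow hsU htU hne
  have hsign := positionSign_mul_positionSign_insert k hsU htU hne
  rw [hinsert_t, hinsert_s] at hcoeff hsign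
  rw [positionSign_erase_self k W s, positionSign_erase_self k W t] at hsign
  generalize (W.erase s).erase t = U at hcoeff hsign
  have hs2 := positionSign_mul_self k U s
  have ht2 := positionSign_mul_self k U t
  linear_combination positionSign k W s * positionSign k U t * hcoeff -
    positionSign k W s * cellCoeff y (W.erase s) s * ht2 -
    positionSign k U s * cellCoeff y (W.erase t) t * hsign +
    positionSign k W t * cellCoeff y (W.erase t) t * hs2

theorem isCompatibleOnCells_of_sparseDifferential_eq_zero : IsCompatibleOnCells y := by
  intro W hc s hs t ht hrs hrt
  obtain rfl | hne := eq_or_ne s t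
  · rfl
  obtain hrow | ⟨r, hr, hrs', hrt', hsr, htr⟩ :=
    hrs.erase_erase_or hrt (by rw [Finset.card_erase_of_mem hs]; omega)
  · exact positionSign_mul_cellCoeff_erase_eq hy hs ht hne hrow
  · exact (positionSign_mul_cellCoeff_erase_eq hy hs hr hrs'.symm hsr).trans
      (positionSign_mul_cellCoeff_erase_eq hy ht hr hrt'.symm htr).symm

end Differential

section Augmentation

theorem isSupportedOnBoundaries_of_sparseAugmentation_eq_zero (hΓ : HasAdjacentProperty n Γ)
    {y : SparseIndex Γ n 0 →₀ GenericRing k n m} (hy : sparseAugmentation k n Γ y = 0) :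
    IsSupportedOnBoundaries y := by
  classical
  intro U s hUs
  obtain ⟨hU, hUc⟩ := isCell_of_cellCoeff_ne_zero hUs
  have hsum := coeff_sparseAugmentation (Finsupp.single s 1 + cellExponent U) y
  rw [hy, coeff_zero, ← Finset.add_sum_erase _ _ (Finset.mem_univ U), if_pos le_add_self,
    add_tsub_cancel_right] at hsum
  obtain ⟨V, hVU, hV⟩ := Finset.exists_ne_zero_of_sum_ne_zero
    fun h0 => hUs (by rw [h0, add_zero] at hsum; exact hsum.symm)
  obtain ⟨hle, hcoeff⟩ := ite_ne_right_iff.mp hV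
  have hVU : V ≠ U := Finset.ne_of_mem_erase hVU
  obtain ⟨hVcell, hVc⟩ : IsCell Γ V ∧ V.card = n := by
    by_contra h
    exact hcoeff (by rw [cellEntry_eq_zero y h, coeff_zero])
  have hsub : V ⊆ insert s U := subset_insert_of_cellExponent_le hle
  have hs : s ∉ U := fun hs => hVU <| Finset.eq_of_subset_of_card_le
    (by rwa [Finset.insert_eq_self.mpr hs] at hsub) (hUc.trans hVc.symm).le
  have hWc : (insert s U).card = n + 1 := by rw [Finset.card_insert_of_notMem hs, hUc, add_zero]
  obtain ⟨t, htV, ht⟩ := Finset.exists_eq_insert_iff.mpr ⟨hsub, by rw [hVc, hWc]⟩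
  have hWs : (insert s U).erase s = U := Finset.erase_insert hs
  have hWt : (insert s U).erase t = V := by rw [← ht, Finset.erase_insert htV]
  refine ⟨hs, isCell_of_isCell_erase₂ hΓ hWc (by rwa [hWs]) (by rwa [hWt])
    (Finset.mem_insert_self s U) (ht ▸ Finset.mem_insert_self t V) ?_⟩
  rintro rfl
  exact hVU (hWt.symm.trans hWs)

theorem coeff_cellExponent_sparseAugmentation (y : SparseIndex Γ n 0 →₀ GenericRing k n m)
    {W : Finset (Fin n ×ₗ Fin m)} (hc : W.card = n + 1) :
    coeff (cellExponent W) (sparseAugmentation k n Γ y) =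
      ∑ r ∈ W, cellCoeff y (W.erase r) r := by
  classical
  have hterm (r) (hr : r ∈ W) : cellCoeff y (W.erase r) r =
      if cellExponent (W.erase r) ≤ cellExponent W then
        coeff (cellExponent W - cellExponent (W.erase r)) (cellEntry y (W.erase r)) else 0 := by
    rw [← single_add_cellExponent_erase hr, if_pos le_add_self, add_tsub_cancel_right, cellCoeff]
  rw [coeff_sparseAugmentation, Finset.sum_congr rfl hterm,
    ← Finset.sum_image (f := fun U => if cellExponent U ≤ cellExponent W then
      coeff (cellExponent W - cellExponent U) (cellEntry y U) else 0) (Finset.erase_injOn W)]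
  refine (Finset.sum_subset (Finset.subset_univ _) fun U _ hU => ?_).symm
  refine ite_eq_right_iff.mpr fun hle => ?_
  rw [cellEntry_eq_zero, coeff_zero]
  rintro ⟨-, hUc⟩
  obtain ⟨r, hr, rfl⟩ :=
    Finset.exists_eq_insert_iff.mpr ⟨subset_of_cellExponent_le hle, by rw [hUc, hc]⟩
  exact hU (Finset.mem_image.mpr ⟨r, Finset.mem_insert_self r U, Finset.erase_insert hr⟩)

theorem isCompatibleOnCells_of_sparseAugmentation_eq_zero
    {y : SparseIndex Γ n 0 →₀ GenericRing k n m} (hy : sparseAugmentation k n Γ y = 0) :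
    IsCompatibleOnCells y := by
  intro W hc p hp q hq hrp hrq
  obtain ⟨s, t, hst, -, hiff⟩ := exists_adjacentIn_meetsEveryRow_erase_iff
    (hrp.mono (Finset.erase_subset p W)) hc
  have hsum : cellCoeff y (W.erase s) s + cellCoeff y (W.erase t) t = 0 := by
    have hcoeff := coeff_cellExponent_sparseAugmentation y hc
    rw [hy, coeff_zero, Finset.sum_eq_add_of_mem s t hst.left_mem hst.right_mem hst.lt.ne] at hcoeff
    · exact hcoeff.symm
    intro r hr hne
    by_contra h
    exact not_or.mpr hne ((hiff r hr).mp (isCell_of_cellCoeff_ne_zero h).1.meetsEveryRow)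
  have hsign : positionSign k W s * cellCoeff y (W.erase s) s =
      positionSign k W t * cellCoeff y (W.erase t) t := by
    rw [hst.positionSign_eq_neg k]
    linear_combination positionSign k W s * hsum
  rcases (hiff p hp).mp hrp with rfl | rfl <;> rcases (hiff q hq).mp hrq with rfl | rfl
  exacts [rfl, hsign, hsign.symm, rfl]

end Augmentation

section Constants

theorem cellEntry_constVec (x : SparseIndex Γ n i →₀ k) :
    cellEntry (constVec (GenericRing k n m) x) = fun U => C (cellEntry x U) := by
  ext1 U
  rw [cellEntry, ← constVec_mapDomain, constVec_apply, algebraMap_eq, cellEntry]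

theorem sparseAugmentation_constVec_injective (x : SparseIndex Γ n 0 →₀ k)
    (hx : sparseAugmentation k n Γ (constVec _ x) = 0) : x = 0 := by
  classical
  ext b
  have h := coeff_sparseAugmentation (cellExponent b.cell) (constVec (GenericRing k n m) x)
  rw [hx, coeff_zero, Finset.sum_eq_single_of_mem b.cell (Finset.mem_univ _), if_pos le_rfl,
    tsub_self, cellEntry_cell, constVec_apply, algebraMap_eq, coeff_zero_C] at h
  · exact h.symm
  · intro U _ hU
    refine ite_eq_right_iff.mpr fun hle => ?_
    rw [cellEntry_eq_zero, coeff_zero]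
    rintro ⟨-, hc⟩
    exact hU (Finset.eq_of_subset_of_card_le (subset_of_cellExponent_le hle)
      (by rw [hc, b.card_cell]))

theorem coeff_sparseDifferential_constVec (x : SparseIndex Γ n (i + 1) →₀ k)
    (b : SparseIndex Γ n i) (s : Fin n ×ₗ Fin m) :
    coeff (Finsupp.single s 1) (sparseDifferential k n Γ i (constVec _ x) b) =
      if s ∈ b.cell then 0 else
        positionSign k b.cell s * cellEntry x (insert s b.cell) := by
  rw [sparseDifferential_apply, cellEntry_constVec, coeff_koszulDifferential_X_C]

theorem SparseIndex.exists_isCell_erase (b : SparseIndex Γ n (i + 1)) :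
    ∃ s ∈ b.cell, IsCell Γ (b.cell.erase s) := by
  obtain ⟨s, t, hst, hr⟩ := exists_adjacentIn_rowOf_eq (W := b.cell) (by rw [b.card_cell]; omega)
  exact ⟨s, hst.left_mem, b.isCell_cell.of_subset (Finset.erase_subset _ _)
    (b.meetsEveryRow_cell.erase hst.right_mem hst.lt.ne' hr.symm)⟩

theorem sparseDifferential_constVec_injective (x : SparseIndex Γ n (i + 1) →₀ k)
    (hx : sparseDifferential k n Γ i (constVec _ x) = 0) : x = 0 := by
  ext b
  obtain ⟨s, hs, hcell⟩ := b.exists_isCell_erase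
  obtain ⟨c, hc⟩ := SparseIndex.exists_cell_eq (i := i) hcell
    (by rw [Finset.card_erase_of_mem hs, b.card_cell]; omega)
  have h := coeff_sparseDifferential_constVec x c s
  rw [hx, Finsupp.zero_apply, coeff_zero, hc, if_neg (Finset.notMem_erase _ _),
    Finset.insert_erase hs, cellEntry_cell] at h
  exact (mul_eq_zero.mp h.symm).resolve_left (positionSign_ne_zero _ _)

theorem isHomogeneous_sparseDifferential_single (c : SparseIndex Γ n (i + 1))
    (b : SparseIndex Γ n i) :
    (sparseDifferential k n Γ i (Finsupp.single c 1) b).IsHomogeneous 1 := by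
  rw [sparseDifferential_single_apply]
  refine IsHomogeneous.sum _ _ _ fun s _ => ?_
  split_ifs
  · rw [positionSign_mvPolynomial, mul_one]
    exact (isHomogeneous_C _ _).mul (isHomogeneous_X k s)
  · exact isHomogeneous_zero _ _ _

theorem IsCompatibleOnCells.exists_cellEntry_eq {y : SparseIndex Γ n i →₀ GenericRing k n m}
    (hy : IsCompatibleOnCells y) : ∃ x : SparseIndex Γ n (i + 1) →₀ k,
      ∀ c : SparseIndex Γ n (i + 1), ∀ s ∈ c.cell, MeetsEveryRow (c.cell.erase s) →
        x c = positionSign k c.cell s * cellCoeff y (c.cell.erase s) s := by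
  choose r hr hcell using fun c : SparseIndex Γ n (i + 1) => c.exists_isCell_erase
  exact ⟨Finsupp.equivFunOnFinite.symm fun c =>
    positionSign k c.cell (r c) * cellCoeff y (c.cell.erase (r c)) (r c),
    fun c s hs hrow => hy c.cell c.card_cell _ (hr c) s hs (hcell c).meetsEveryRow hrow⟩

theorem exists_sparseDifferential_constVec_eq {y : SparseIndex Γ n i →₀ GenericRing k n m}
    (hlin : ∀ b, (y b).IsHomogeneous 1) (hsupp : IsSupportedOnBoundaries y)
    (hcomp : IsCompatibleOnCells y) :
      ∃ x : SparseIndex Γ n (i + 1) →₀ k, sparseDifferential k n Γ i (constVec _ x) = y := by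
  obtain ⟨x, hx⟩ := hcomp.exists_cellEntry_eq
  refine ⟨x, Finsupp.ext fun b => eq_of_coeff_single_eq (isHomogeneous_map_constVec
    (f := Finsupp.lapply b ∘ₗ sparseDifferential k n Γ i)
    (fun c => isHomogeneous_sparseDifferential_single c b) x) (hlin b) fun s => ?_⟩
  rw [coeff_sparseDifferential_constVec, ← cellEntry_cell y b]
  change _ = cellCoeff y b.cell s
  by_cases hs : s ∉ b.cell ∧ IsCell Γ (insert s b.cell)
  · obtain ⟨c, hc⟩ := SparseIndex.exists_cell_eq (i := i + 1) hs.2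
      (by rw [Finset.card_insert_of_notMem hs.1, b.card_cell, add_assoc])
    have herase : c.cell.erase s = b.cell := by rw [hc, Finset.erase_insert hs.1]
    rw [if_neg hs.1, ← hc, cellEntry_cell, hx c s (hc ▸ Finset.mem_insert_self s _)
      (herase ▸ b.meetsEveryRow_cell), ← herase, positionSign_erase_self, ← mul_assoc,
      positionSign_mul_self, one_mul]
  · rw [not_imp_comm.mp (hsupp b.cell s) hs]
    refine ite_eq_left_iff.mpr fun hsb => ?_
    rw [cellEntry_eq_zero x fun h => hs ⟨hsb, h.1⟩, mul_zero]

end Constants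

theorem sparseEagonNorthcott_d_zero_eq_zero_iff {y : SparseIndex Γ n 0 →₀ GenericRing k n m} :
    (sparseEagonNorthcott k n Γ).d 0 y = 0 ↔ sparseAugmentation k n Γ y = 0 :=
  GradedFreeSequence.augment_d_zero_eq_zero_iff (sparseAugmentation_homogeneous k n Γ)

theorem isLinearStrand_sparseEagonNorthcott (hΓ : HasAdjacentProperty n Γ) :
    (sparseEagonNorthcott k n Γ).IsLinearStrand where
  injective
    | 0, x, hx => sparseAugmentation_constVec_injective x
        (sparseEagonNorthcott_d_zero_eq_zero_iff.mp hx)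
    | _ + 1, x, hx => sparseDifferential_constVec_injective x hx
  linear _ := isHomogeneous_sparseDifferential_single
  isComplex
    | 0 => LinearMap.ext fun x => sparseEagonNorthcott_d_zero_eq_zero_iff.mpr
        (sparseAugmentation_sparseDifferential x)
    | _ + 1 => LinearMap.ext sparseDifferential_sparseDifferential
  exact
    | 0, _, hlin, hy =>
      have hy := sparseEagonNorthcott_d_zero_eq_zero_iff.mp hy
      exists_sparseDifferential_constVec_eq hlin
        (isSupportedOnBoundaries_of_sparseAugmentation_eq_zero hΓ hy)
        (isCompatibleOnCells_of_sparseAugmentation_eq_zero hy)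
    | _ + 1, _, hlin, hy => exists_sparseDifferential_constVec_eq hlin
        (isSupportedOnBoundaries_of_sparseDifferential_eq_zero hy hΓ)
        (isCompatibleOnCells_of_sparseDifferential_eq_zero hy)

end LinearCycles

/-! ### Clique complexes -/

section Clique

variable {n m : ℕ} {Γ Δ : PreAbstractSimplicialComplex (Fin m)}

theorem AdjacentIn.isNonface_one {σ : Finset (Fin m)} {u v : Fin m} (h : AdjacentIn σ u v)
    (hσ : σ ∉ Γ) (hu : σ.erase u ∈ Γ) (hv : σ.erase v ∈ Γ) : IsNonface Γ 1 σ := by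
  obtain ⟨j, hj, rfl, rfl⟩ := h.exists_orderEmbOfFin_eq
  refine ⟨hσ, j, hj, fun l hl => ?_⟩
  obtain rfl | rfl := Nat.le_one_iff_eq_zero_or_eq_one.mp hl
  exacts [hu, hv]

theorem hasAdjacentProperty_cliqueComplex
    (h : ∀ σ : Finset (Fin m), σ.card = n + 1 → ¬ IsNonface (cliqueComplex Δ n) 1 σ) :
    HasAdjacentProperty n (cliqueComplex Δ n) := by
  intro σ hσ u v huv hu hv
  refine ⟨⟨u, huv.left_mem⟩, fun ρ hρ hne hcard => ?_⟩
  by_cases huρ : u ∈ ρ; swap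
  · exact hu.2 ρ (Finset.subset_erase.mpr ⟨hρ, huρ⟩) hne hcard
  by_cases hvρ : v ∈ ρ; swap
  · exact hv.2 ρ (Finset.subset_erase.mpr ⟨hρ, hvρ⟩) hne hcard
  obtain ⟨υ, hρυ, hυσ, hυ⟩ := Finset.exists_subsuperset_card_eq hρ
    (hcard.trans (Nat.le_succ n)) (Nat.succ_le_of_lt hσ)
  have herase {x y : Fin m} (hxy : y ≠ x) (hy : y ∈ ρ)
      (hx : σ.erase x ∈ cliqueComplex Δ n) : υ.erase x ∈ cliqueComplex Δ n :=
    ((cliqueComplex Δ n).isRelLowerSet_faces hx).2 (Finset.erase_subset_erase x hυσ)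
      ⟨y, Finset.mem_erase.mpr ⟨hxy, hρυ hy⟩⟩
  have hυmem : υ ∈ cliqueComplex Δ n := by
    by_contra hυmem
    exact h υ hυ ((huv.mono hυσ (hρυ huρ) (hρυ hvρ)).isNonface_one hυmem
      (herase huv.lt.ne' hvρ hu) (herase huv.lt.ne huρ hv))
  exact hυmem.2 ρ hρυ hne hcard

theorem IsPureOfCard.maximal_iff_mem_cliqueComplex (hΔ : IsPureOfCard Δ n) {σ : Finset (Fin m)}
    (hσ : σ.card = n) : Maximal (· ∈ Δ) σ ↔ σ ∈ cliqueComplex Δ n := by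
  refine ⟨fun h => ?_, fun h => ?_⟩
  · obtain ⟨hne, hsub⟩ := Δ.isRelLowerSet_faces h.prop
    exact ⟨hne, fun ρ hρ hρne _ => hsub hρ hρne⟩
  · obtain ⟨ρ, hσρ, hρ⟩ := (Set.toFinite {ρ | ρ ∈ Δ}).exists_le_maximal
      (h.2 σ subset_rfl h.1 hσ.le)
    have hσρ : σ = ρ := Finset.eq_of_subset_of_card_le hσρ (by rw [hΔ ρ hρ, hσ])
    exact hσρ ▸ hρ

variable {k : Type*} [Field k]

theorem sparseAugmentation_constVec (x : SparseIndex Γ n 0 →₀ k) :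
    sparseAugmentation k n Γ (constVec _ x) = Finsupp.linearCombination k
      (fun b : SparseIndex Γ n 0 =>
        MonomialOrder.lex.leadingTerm (maximalMinor (n := n) k b.σ b.card_eq)) x := by
  induction x using Finsupp.induction_linear with
  | zero => simp only [map_zero]
  | add x y hx hy => simp only [map_add, hx, hy]
  | single b r => rw [constVec_single, sparseAugmentation, Finsupp.linearCombination_single,
      Finsupp.linearCombination_single, algebraMap_smul]

theorem IsPureOfCard.range_leadingTerm_maximalMinor (hΔ : IsPureOfCard Δ n) :
    (Set.range fun b : SparseIndex (cliqueComplex Δ n) n 0 =>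
      MonomialOrder.lex.leadingTerm (maximalMinor (n := n) k b.σ b.card_eq)) =
        MonomialOrder.lex.leadingTerm ''
          {p | ∃ σ h, Maximal (· ∈ Δ) σ ∧ p = maximalMinor k σ h} := by
  refine subset_antisymm ?_ ?_
  · rintro _ ⟨b, rfl⟩
    exact ⟨_, ⟨b.σ, b.card_eq, (hΔ.maximal_iff_mem_cliqueComplex b.card_eq).mpr b.mem, rfl⟩, rfl⟩
  · rintro _ ⟨_, ⟨σ, h, hσ, rfl⟩, rfl⟩
    exact ⟨⟨0, σ, (hΔ.maximal_iff_mem_cliqueComplex h).mp hσ, h, by simp⟩, rfl⟩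

theorem IsPureOfCard.exists_sparseAugmentation_constVec_eq_iff (hΔ : IsPureOfCard Δ n)
    {p : GenericRing k n m} :
    (∃ x : SparseIndex (cliqueComplex Δ n) n 0 →₀ k,
      sparseAugmentation k n (cliqueComplex Δ n) (constVec _ x) = p) ↔
      p ∈ lexInitialIdeal (determinantalFacetIdeal k n Δ) ∧ p.IsHomogeneous n := by
  rw [mem_lexInitialIdeal_and_isHomogeneous_iff, ← hΔ.range_leadingTerm_maximalMinor,
    ← Finsupp.range_linearCombination, LinearMap.mem_range]
  simp only [sparseAugmentation_constVec]

end Clique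

theorem mainTheorem1 {k : Type*} [Field k] {n m : ℕ} (hn : 1 ≤ n) (hnm : n ≤ m)
    (Δ : PreAbstractSimplicialComplex (Fin m)) (hpure : IsPureOfCard Δ n)
    (hnonface : ∀ σ : Finset (Fin m), σ.card = n + 1 → ¬ IsNonface (cliqueComplex Δ n) 1 σ)
    (F : MinimalGradedFreeResolution (lexInitialIdeal (determinantalFacetIdeal k n Δ))) :
    (sparseEagonNorthcott k n (cliqueComplex Δ n)).IsComplex ∧
      Nonempty ((F.augmentedLinearStrand n).Iso
        (sparseEagonNorthcott k n (cliqueComplex Δ n))) := by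
  have hI : ∀ p ∈ lexInitialIdeal (determinantalFacetIdeal k n Δ), p ≠ 0 →
      ∀ e, p.IsHomogeneous e → n ≤ e := fun _ hp hp0 _ => le_of_mem_lexInitialIdeal hp hp0
  have hF := F.isLinearStrand_augmentedLinearStrand hI
  have hC : (sparseEagonNorthcott k n (cliqueComplex Δ n)).IsLinearStrand :=
    isLinearStrand_sparseEagonNorthcott (hasAdjacentProperty_cliqueComplex hnonface)
  refine ⟨hC.isComplex, hF.nonempty_iso_augment hC (fun _ b _ => b.2) fun p => ?_⟩
  exact (F.exists_strandAugmentation_constVec_eq_iff hI).trans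
    hpure.exists_sparseAugmentation_constVec_eq_iff.symm
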